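/- **Setting.** Let $(\mathcal X,\mathscr X)$ be a measurable space with countably generated $\sigma$-algebra (e.g. $\mathcal X\subseteq\mathbb R^d$ with its Borel sets), $Q$ a Markov kernel on $\mathcal X$ with stationary probability distribution $Q_0$, and $Q_0\otimes Q$ the induced law of $(X_t,X_{t+1})$. Let $\beta\in(0,1)$, $\theta>0$, $\alpha=-\frac{1}{\theta(1-\beta)}$ and $u:\mathcal X^2\to\mathbb R$. For $s\ge 1$ put $\phi_s(x)=e^{x^s}-1$ and, for measurable $f$ and a probability measure $\mu$, $\|f\|_{L^{\phi_s}(\mu)}=\inf\{c>0:\int\phi_s(|f|/c)\,d\mu\le 1\}$. $L^{\phi_s}(\mu)$ is the set of $f$ with $\|f\|_{L^{\phi_s}(\mu)}<\infty$, and $E^{\phi_s}(\mu)$ is the set of those with $\int\phi_s(|f|/c)\,d\mu<\infty$ for all $c>0$; functions equal $\mu$-a.e. are identified. $\|\cdot\|_{\phi_s}$ denotes this norm under $Q_0$ for functions of $X_t$ and under $Q_0\otimes Q$ for functions of $(X_t,X_{t+1})$; $\|\cdot\|_p$ is the $L^p(Q_0\otimes Q)$ norm. For a Markov kernel $\hat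 Q$ let $\hat{\mathbb T}f(x)=\beta\log\int e^{f(y)+\alpha u(x,y)}\,\hat Q(dy|x)$, and let $\mathbb T$ be this operator for $\hat Q=Q$. If $\hat Q(\cdot|x)$ and $Q(\cdot|x)$ are mutually absolutely continuous for every $x$, let $\hat\ell(x,y)=\log\frac{d\hat Q(\cdot|x)}{dQ(\cdot|x)}(y)$ and $\hat\eta(x,y)=\hat\ell(x,y)-\int\hat\ell(x,y')\,Q(dy'|x)$. *Assumption U:* $u\in E^{\phi_r}(Q_0\otimes Q)$ for some $r>1$. Fix this $r$, and a finite $M\ge\int \exp(|\frac{\alpha}{1-\beta}u|^r)\,d(Q_0\otimes Q)$. *Assumption AM2* (for $\hat Q$): $\hat Q(\cdot|x)$ and $Q(\cdot|x)$ are mutually absolutely continuous for every $x$, and either (a) $\hat\ell\in E^{\phi_r}(Q_0\otimes Q)$, $\|\hat\ell\|_{\phi_r}\le M$ and $\int\exp(|\frac{1}{1-\beta}(\hat\ell+\alpha u)|^r)\,d(Q_0\otimes Q)\le M$; or (b) $\hat\ell\in L^{\phi_1}(Q_0\otimes Q)$, $\hat Q$ has a stationary probability distribution $\hat Q_0$ mutually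 absolutely continuous with $Q_0$, and there is $p>1$ such that, with $\hat\Delta=\frac{d\hat Q_0}{dQ_0}$ and $\hat\Delta_2=\frac{d(\hat Q_0\otimes\hat Q)}{d(Q_0\otimes Q)}$, the integrals $\int\hat\Delta^p\,dQ_0$, $\int\hat\Delta^{1-p}\,dQ_0$ and $\int\hat\Delta_2^p\,d(Q_0\otimes Q)$ are all at most $M$. **Proposition 5.1.** Let Assumption U hold, let $\hat Q=\hat Q_n$ be a sequence of random Markov kernels which satisfies AM2 with probability approaching one (wpa1), let $\|\hat\eta\|_{\phi_1}=o_p(1)$, and let $a_n>0$, $a_n\to 0$. Then $\mathbb T$ has a fixed point $v\in E^{\phi_r}(Q_0)$ and, wpa1, $\hat{\mathbb T}$ has a fixed point $\hat v\in E^{\phi_r}(Q_0)$; each is the unique fixed point of its operator in $E^{\phi_s}(Q_0)$ for every $1<s\le r$. Let $$m_v(x,y)=\frac{e^{v(y)+\alpha u(x,y)}}{\int e^{v(y')+\alpha u(x,y')}\,Q(dy'|x)},\qquad m_{\hat v}(x,y)=e^{\hat v(y)+\alpha u(x,y)-\beta^{-1}\hat v(x)}.$$ If $\|\hat{\mathbb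 T}v-v\|_{\phi_1}=O_p(a_n)$, then $$\|\hat v-v\|_{\phi_1}=O_p(a_n),$$ and, for every $1<p<\infty$, $$\|m_{\hat v}-m_v\|_p=O_p(a_n)\quad\text{and}\quad \Big\|\frac{m_{\hat v}}{m_v}-1\Big\|_p=O_p(a_n).$$ -/

import Mathlib

open MeasureTheory ProbabilityTheory Filter Topology
open scoped ENNReal

namespace RobustCV

noncomputable section

/-! ### Exponential Orlicz spaces -/

/-- The modular `∫ φ_r(|f| / c) dμ` of the Young function `φ_r(x) = exp(x ^ r) - 1`. -/
def orliczModular {S : Type*} [MeasurableSpace S] (r : ℝ) (f : S → ℝ) (μ : Measure S)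
    (c : ℝ) : ℝ≥0∞ :=
  ∫⁻ x, ENNReal.ofReal (Real.exp ((|f x| / c) ^ r) - 1) ∂μ

/-- The Luxemburg norm `‖f‖_{φ_r} = inf {c > 0 : ∫ φ_r(|f| / c) dμ ≤ 1}`, with value `∞` when
no such `c` exists. -/
def luxNorm {S : Type*} [MeasurableSpace S] (r : ℝ) (f : S → ℝ) (μ : Measure S) : ℝ≥0∞ :=
  ⨅ (c : ℝ) (_ : 0 < c ∧ orliczModular r f μ c ≤ 1), ENNReal.ofReal c

/-- Membership in the Orlicz space `L^{φ_r}(μ)`. -/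
def MemOrlicz {S : Type*} [MeasurableSpace S] (r : ℝ) (f : S → ℝ) (μ : Measure S) : Prop :=
  Measurable f ∧ luxNorm r f μ < ∞

/-- Membership in the Orlicz heart `E^{φ_r}(μ)`. -/
def MemOrliczHeart {S : Type*} [MeasurableSpace S] (r : ℝ) (f : S → ℝ) (μ : Measure S) : Prop :=
  MemOrlicz r f μ ∧ ∀ c : ℝ, 0 < c → orliczModular r f μ c < ∞

/-! ### The continuation value recursion -/

/-- `α = -1 / (θ (1 - β))`. -/
def riskCoef (β θ : ℝ) : ℝ := -1 / (θ * (1 - β))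

variable {X : Type*} [MeasurableSpace X]

/-- The operator `f ↦ β log E^K[exp(f(X_{t+1}) + α u(X_t, X_{t+1})) | X_t = x]`, with
`α = riskCoef β θ`, for the transition kernel `K`. -/
def cvOp (β θ : ℝ) (u : X × X → ℝ) (K : Kernel X X) (f : X → ℝ) (x : X) : ℝ :=
  β * Real.log (∫ y, Real.exp (f y + riskCoef β θ * u (x, y)) ∂(K x))

/-- `f` is a fixed point, in `E^{φ_s}(Q₀)`, of the operator of the kernel `K`. Elements of
`E^{φ_s}(Q₀)` are identified when they agree `Q₀`-almost everywhere. -/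
def IsFixedPt (s β θ : ℝ) (u : X × X → ℝ) (Q₀ : Measure X) (K : Kernel X X) (f : X → ℝ) : Prop :=
  MemOrliczHeart s f Q₀ ∧ cvOp β θ u K f =ᵐ[Q₀] f

/-- `f` is a fixed point in `E^{φ_r}(Q₀)`, and it is the only fixed point in `E^{φ_s}(Q₀)` for
each `1 < s ≤ r`. -/
def IsUniqueFixedPt (r β θ : ℝ) (u : X × X → ℝ) (Q₀ : Measure X) (K : Kernel X X)
    (f : X → ℝ) : Prop :=
  IsFixedPt r β θ u Q₀ K f ∧
    ∀ s : ℝ, 1 < s → s ≤ r → ∀ g : X → ℝ, IsFixedPt s β θ u Q₀ K g → g =ᵐ[Q₀] f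

/-- The worst-case belief distortion
`m_v(x, y) = exp(v(y) + α u(x, y)) / E^Q[exp(v(X_{t+1}) + α u(X_t, X_{t+1})) | X_t = x]`. -/
def distortion (β θ : ℝ) (u : X × X → ℝ) (Q : Kernel X X) (v : X → ℝ) (z : X × X) : ℝ :=
  Real.exp (v z.2 + riskCoef β θ * u z) /
    ∫ y, Real.exp (v y + riskCoef β θ * u (z.1, y)) ∂(Q z.1)

/-- The estimated worst-case belief distortion
`m_{v̂}(x, y) = exp(v̂(y) + α u(x, y) - β⁻¹ v̂(x))`. -/
def distortionEst (β θ : ℝ) (u : X × X → ℝ) (vhat : X → ℝ) (z : X × X) : ℝ :=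
  Real.exp (vhat z.2 + riskCoef β θ * u z - β⁻¹ * vhat z.1)

/-! ### Perturbed kernels -/

/-- The log likelihood ratio `ℓ̂(x, y) = log (dQ̂(·|x) / dQ(·|x))(y)`, through the jointly
measurable version of the Radon–Nikodym derivative. -/
def logRatio [MeasurableSpace.CountablyGenerated X] (Q Qhat : Kernel X X) (z : X × X) : ℝ :=
  Real.log (Kernel.rnDeriv Qhat Q z.1 z.2).toReal

/-- `η̂(x, y) = ℓ̂(x, y) - E^Q[ℓ̂(X_t, X_{t+1}) | X_t = x]`. -/
def score [MeasurableSpace.CountablyGenerated X] (Q Qhat : Kernel X X) (z : X × X) : ℝ :=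
  logRatio Q Qhat z - ∫ y, logRatio Q Qhat (z.1, y) ∂(Q z.1)

/-- Everywhere mutual absolute continuity of two kernels. -/
def EverywhereMAC (Q Qhat : Kernel X X) : Prop :=
  ∀ x, Q x ≪ Qhat x ∧ Qhat x ≪ Q x

/-- The uniform regularity condition AM2 on an alternative kernel `Qhat`, relative to `Q` with
stationary distribution `Q₀`: mutual absolute continuity together with
(a) a thin-tailed log likelihood ratio with bounds by `M`, or
(b) `ℓ̂ ∈ L^{φ_1}`, stationarity under `Qhat` with a stationary distribution `Qhat₀` equivalent to
`Q₀`, and, for some `p > 1`, moment bounds by `M` on the densities of `Qhat₀` with respect to `Q₀`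
and of `Qhat₀ ⊗ Qhat` with respect to `Q₀ ⊗ Q`. -/
def AM2 [MeasurableSpace.CountablyGenerated X] (r β θ M : ℝ) (u : X × X → ℝ) (Q₀ : Measure X)
    (Q Qhat : Kernel X X) : Prop :=
  EverywhereMAC Q Qhat ∧
    ((MemOrliczHeart r (logRatio Q Qhat) (Q₀ ⊗ₘ Q) ∧
        luxNorm r (logRatio Q Qhat) (Q₀ ⊗ₘ Q) ≤ ENNReal.ofReal M ∧
        ∫⁻ z, ENNReal.ofReal (Real.exp
          (|1 / (1 - β) * (logRatio Q Qhat z + riskCoef β θ * u z)| ^ r)) ∂(Q₀ ⊗ₘ Q)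
            ≤ ENNReal.ofReal M) ∨
      (MemOrlicz 1 (logRatio Q Qhat) (Q₀ ⊗ₘ Q) ∧
        ∃ Qhat₀ : Measure X, IsProbabilityMeasure Qhat₀ ∧ Kernel.Invariant Qhat Qhat₀ ∧
          Q₀ ≪ Qhat₀ ∧ Qhat₀ ≪ Q₀ ∧
          ∃ p : ℝ, 1 < p ∧
            ∫⁻ x, Qhat₀.rnDeriv Q₀ x ^ p ∂Q₀ ≤ ENNReal.ofReal M ∧
            ∫⁻ x, Qhat₀.rnDeriv Q₀ x ^ (1 - p) ∂Q₀ ≤ ENNReal.ofReal M ∧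
            ∫⁻ z, (Qhat₀ ⊗ₘ Qhat).rnDeriv (Q₀ ⊗ₘ Q) z ^ p ∂(Q₀ ⊗ₘ Q) ≤ ENNReal.ofReal M))

/-! ### Stochastic order symbols

As `P` is applied to sets that need not be measurable, these are statements about outer
probability. -/

variable {Ω : Type*} [MeasurableSpace Ω]

/-- The events `A n` hold with probability approaching one. -/
def WPA1 (P : Measure Ω) (A : ℕ → Ω → Prop) : Prop :=
  Tendsto (fun n => P {ω | ¬ A n ω}) atTop (𝓝 0)

/-- `Z_n = o_p(1)` for `[0, ∞]`-valued `Z_n`. -/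
def IsLittleOP (P : Measure Ω) (Z : ℕ → Ω → ℝ≥0∞) : Prop :=
  ∀ ε : ℝ, 0 < ε → Tendsto (fun n => P {ω | ENNReal.ofReal ε < Z n ω}) atTop (𝓝 0)

/-- `Z_n = O_p(a_n)` for `[0, ∞]`-valued `Z_n` and positive reals `a_n`. -/
def IsBigOP (P : Measure Ω) (Z : ℕ → Ω → ℝ≥0∞) (a : ℕ → ℝ) : Prop :=
  ∀ ε : ℝ, 0 < ε → ∃ C : ℝ, 0 < C ∧
    ∀ᶠ n in atTop, P {ω | ENNReal.ofReal (C * a n) < Z n ω} ≤ ENNReal.ofReal ε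

end

end RobustCV

namespace RobustCV

noncomputable section

/-! Write `T f = β log ∫ exp(f + U) dK` with `U = αu`. Since `T` is convex, extrapolation turns
approximate fixed points into approximate subsolutions. If `T f₀ = f₀ + d₀` and `T f₁ = f₁ + d₁`,
then `f₀` is a convex combination of `f₁` and `h = (1 + t) f₀ - t f₁`, so `T h ≥ h + (1 + t) d₀ - t
d₁`. Any subsolution obeys an a priori bound: exponentiate, integrate against the stationary law and
use weighted AM-GM. This bounds the moment of `exp(h / β)` by a quantity in which `t` appears only
multiplied by the residuals (`extrapolation_bound`).

With zero residuals, `t → ∞` forces `f₀ ≤ f₁`, which is uniqueness (`fixedPt_ae_le`). With a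
residual of Orlicz size `c`, taking `t` of order `1 / c` bounds an exponential moment of `|f₀ - f₁|
/ c`, which is the rate (`expMoment_fixedPt_sub_le`). No contraction or derivative of `T` is needed.

Existence (`exists_fixedPt`) is monotone iteration for `G = exp(v / β)`, that is `G = ∫ G ^ β exp(U)
dK`. The problem with `|U|` gives a dominating solution `H`, and `1 / H` starts an increasing
iteration for `U` that stays below `H`. Tails are controlled through the majorant `expPowLog`.

The estimated kernel is absorbed into the exponent: its operator is that of `Q` with `αu + ℓ̂`, so
stationarity of `Q₀` under `Q` still serves. A small score controls the exponential moments of `ℓ̂`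
(`expMoment_logRatio_le`). The distortions are exponentials of the fixed points, and their errors
have the form `exp(g) (exp(z) - 1)` with `z` of the order of the error of the fixed point. -/

/-! ### Exponential moments -/

/-- The exponential moment `∫ exp(f) dμ`, as an extended nonnegative real. -/
def expMoment {S : Type*} [MeasurableSpace S] (μ : Measure S) (f : S → ℝ) : ℝ≥0∞ :=
  ∫⁻ x, ENNReal.ofReal (Real.exp (f x)) ∂μ

/-- `f` is measurable and `exp(k f)` is integrable for every real `k`. -/
def HasExpMoments {S : Type*} [MeasurableSpace S] (μ : Measure S) (f : S → ℝ) : Prop :=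
  Measurable f ∧ ∀ k : ℝ, expMoment μ (fun x => k * f x) < ∞

lemma ofReal_exp_convex {b : ℝ} (hb₀ : 0 ≤ b) (hb₁ : b ≤ 1) (x y : ℝ) :
    ENNReal.ofReal (Real.exp (b * x + (1 - b) * y)) ≤
      ENNReal.ofReal b * ENNReal.ofReal (Real.exp x) +
        ENNReal.ofReal (1 - b) * ENNReal.ofReal (Real.exp y) := by
  rw [← ENNReal.ofReal_mul hb₀, ← ENNReal.ofReal_mul (by linarith),
    ← ENNReal.ofReal_add (by positivity) (mul_nonneg (by linarith) (Real.exp_nonneg _))]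
  apply ENNReal.ofReal_le_ofReal
  have := convexOn_exp.2 (Set.mem_univ x) (Set.mem_univ y) hb₀
    (show (0 : ℝ) ≤ 1 - b by linarith) (by ring)
  simpa only [smul_eq_mul] using this

lemma ofReal_exp_half_add (x y : ℝ) :
    ENNReal.ofReal (Real.exp ((x + y) / 2)) ≤
      ENNReal.ofReal (Real.exp x) + ENNReal.ofReal (Real.exp y) := by
  rw [← ENNReal.ofReal_add (by positivity) (by positivity)]
  apply ENNReal.ofReal_le_ofReal
  rcases le_total x y with h | h
  · have : Real.exp ((x + y) / 2) ≤ Real.exp y := Real.exp_le_exp.2 (by linarith)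
    linarith [Real.exp_pos x]
  · have : Real.exp ((x + y) / 2) ≤ Real.exp x := Real.exp_le_exp.2 (by linarith)
    linarith [Real.exp_pos y]

section Moments

variable {S : Type*} [MeasurableSpace S] {μ : Measure S}

lemma measurable_ofReal_exp {f : S → ℝ} (hf : Measurable f) :
    Measurable fun x => ENNReal.ofReal (Real.exp (f x)) := by fun_prop

lemma expMoment_mono {f g : S → ℝ} (h : ∀ x, f x ≤ g x) : expMoment μ f ≤ expMoment μ g :=
  lintegral_mono fun x => ENNReal.ofReal_le_ofReal (Real.exp_le_exp.2 (h x))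

lemma expMoment_half_add_le {f g : S → ℝ} (hf : Measurable f) :
    expMoment μ (fun x => (f x + g x) / 2) ≤ expMoment μ f + expMoment μ g := by
  unfold expMoment
  rw [← lintegral_add_left (measurable_ofReal_exp hf)]
  exact lintegral_mono fun x => ofReal_exp_half_add _ _

lemma expMoment_abs_le {f : S → ℝ} (hf : Measurable f) :
    expMoment μ (fun x => |f x|) ≤ expMoment μ f + expMoment μ (fun x => -f x) := by
  unfold expMoment
  rw [← lintegral_add_left (measurable_ofReal_exp hf)]
  refine lintegral_mono fun x => ?_
  rcases abs_cases (f x) with ⟨h, -⟩ | ⟨h, -⟩ <;> simp only [h]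
  · exact le_self_add
  · exact le_add_self

lemma expMoment_pos [IsProbabilityMeasure μ] {f : S → ℝ} (hf : Measurable f) :
    0 < expMoment μ f := by
  unfold expMoment
  rw [lintegral_pos_iff_support (measurable_ofReal_exp hf)]
  have : Function.support (fun x => ENNReal.ofReal (Real.exp (f x))) = Set.univ := by
    ext x; simp [Real.exp_pos]
  rw [this]; simp

lemma integral_exp_eq_expMoment {f : S → ℝ} (hf : Measurable f) :
    ∫ x, Real.exp (f x) ∂μ = (expMoment μ f).toReal := by
  rw [integral_eq_lintegral_of_nonneg_ae (Eventually.of_forall fun x => (Real.exp_pos _).le)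
    (by fun_prop)]
  rfl

/-- The geometric convexity of exponential moments (Hölder's inequality). -/
lemma expMoment_convex {f g : S → ℝ} (hf : Measurable f) (hg : Measurable g) {p q : ℝ}
    (hp : 0 ≤ p) (hq : 0 ≤ q) (hpq : p + q = 1) :
    expMoment μ (fun x => p * f x + q * g x) ≤ expMoment μ f ^ p * expMoment μ g ^ q := by
  refine le_trans (le_of_eq ?_) (ENNReal.lintegral_mul_norm_pow_le
    (measurable_ofReal_exp hf).aemeasurable (measurable_ofReal_exp hg).aemeasurable hp hq hpq)
  refine lintegral_congr fun x => ?_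
  rw [ENNReal.ofReal_rpow_of_pos (Real.exp_pos _), ENNReal.ofReal_rpow_of_pos (Real.exp_pos _),
    ← ENNReal.ofReal_mul (by positivity), ← Real.exp_mul, ← Real.exp_mul, ← Real.exp_add]
  congr 2; ring

lemma HasExpMoments.const_mul {f : S → ℝ} (hf : HasExpMoments μ f) (c : ℝ) :
    HasExpMoments μ (fun x => c * f x) :=
  ⟨hf.1.const_mul c, fun k => by simpa only [mul_assoc] using hf.2 (k * c)⟩

lemma HasExpMoments.add {f g : S → ℝ} (hf : HasExpMoments μ f) (hg : HasExpMoments μ g) :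
    HasExpMoments μ (fun x => f x + g x) := by
  refine ⟨hf.1.add hg.1, fun k => ?_⟩
  refine lt_of_le_of_lt ?_ (ENNReal.add_lt_top.2 ⟨hf.2 (2 * k), hg.2 (2 * k)⟩)
  refine le_trans (le_of_eq ?_) (expMoment_half_add_le (hf.1.const_mul _))
  congr 1; ext x; ring

lemma HasExpMoments.sub {f g : S → ℝ} (hf : HasExpMoments μ f) (hg : HasExpMoments μ g) :
    HasExpMoments μ (fun x => f x - g x) := by
  have := hf.add (hg.const_mul (-1))
  simpa only [neg_one_mul, ← sub_eq_add_neg] using this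

end Moments

/-! ### Exponential Orlicz hearts -/

section Orlicz

variable {S : Type*} [MeasurableSpace S] {μ : Measure S}

lemma orliczModular_add_one [IsProbabilityMeasure μ] {r : ℝ} {f : S → ℝ}
    {c : ℝ} (hc : 0 < c) :
    orliczModular r f μ c + 1 = expMoment μ (fun x => (|f x| / c) ^ r) := by
  have h1 : (1 : ℝ≥0∞) = ∫⁻ _, 1 ∂μ := by simp
  rw [h1]
  unfold orliczModular expMoment
  rw [← lintegral_add_right _ measurable_const]
  refine lintegral_congr fun x => ?_
  have h0 : (0 : ℝ) ≤ (|f x| / c) ^ r := by positivity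
  have : (0 : ℝ) ≤ Real.exp ((|f x| / c) ^ r) - 1 := by linarith [Real.add_one_le_exp ((|f x| / c) ^ r)]
  rw [← ENNReal.ofReal_one, ← ENNReal.ofReal_add this zero_le_one]
  congr 1; ring

lemma orliczModular_anti {r : ℝ} (hr : 0 ≤ r) {f : S → ℝ} {c c' : ℝ} (hc : 0 < c) (h : c ≤ c') :
    orliczModular r f μ c' ≤ orliczModular r f μ c := by
  refine lintegral_mono fun x => ENNReal.ofReal_le_ofReal (sub_le_sub_right ?_ _)
  refine Real.exp_le_exp.2 (Real.rpow_le_rpow (div_nonneg (abs_nonneg _) (hc.le.trans h)) ?_ hr)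
  exact div_le_div_of_nonneg_left (abs_nonneg _) hc h

lemma orliczModular_le_one_of_luxNorm_lt {r : ℝ} (hr : 0 ≤ r) {f : S → ℝ} {c : ℝ}
    (h : luxNorm r f μ < ENNReal.ofReal c) : orliczModular r f μ c ≤ 1 := by
  unfold luxNorm at h
  simp only [iInf_lt_iff] at h
  obtain ⟨c', ⟨hc', h1⟩, h2⟩ := h
  exact (orliczModular_anti hr hc' (ENNReal.ofReal_lt_ofReal_iff'.1 h2).1.le).trans h1

/-- Convexity of `φ_r` and `φ_r(0) = 0` give `φ_r(s / m) ≤ φ_r(s) / m`. A finite modular bound thus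
costs only a constant factor in the norm. -/
lemma luxNorm_le_of_modular_le {r : ℝ} (hr : 1 ≤ r) {f : S → ℝ} {c m : ℝ} (hc : 0 < c)
    (hm : 1 ≤ m) (h : orliczModular r f μ c ≤ ENNReal.ofReal m) :
    luxNorm r f μ ≤ ENNReal.ofReal (m * c) := by
  have hm0 : 0 < m := by linarith
  refine iInf₂_le_of_le (m * c) ⟨by positivity, ?_⟩ le_rfl
  have key : ∀ x, ENNReal.ofReal (Real.exp ((|f x| / (m * c)) ^ r) - 1) ≤
      ENNReal.ofReal m⁻¹ * ENNReal.ofReal (Real.exp ((|f x| / c) ^ r) - 1) := by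
    intro x
    rw [← ENNReal.ofReal_mul (by positivity)]
    apply ENNReal.ofReal_le_ofReal
    set t := |f x| / c with ht
    have ht0 : 0 ≤ t := by positivity
    have e1 : |f x| / (m * c) = m⁻¹ * t := by rw [ht]; field_simp
    have hinv : m⁻¹ ≤ 1 := inv_le_one_of_one_le₀ hm
    have hi0 : 0 < m⁻¹ := by positivity
    have e2 : (m⁻¹ * t) ^ r ≤ m⁻¹ * t ^ r := by
      rw [Real.mul_rpow hi0.le ht0]
      refine mul_le_mul_of_nonneg_right ?_ (by positivity)
      calc m⁻¹ ^ r ≤ m⁻¹ ^ (1 : ℝ) := Real.rpow_le_rpow_of_exponent_ge hi0 hinv hr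
        _ = m⁻¹ := Real.rpow_one _
    have := convexOn_exp.2 (Set.mem_univ (t ^ r)) (Set.mem_univ 0) hi0.le
      (show (0 : ℝ) ≤ 1 - m⁻¹ by linarith) (by ring)
    simp only [smul_eq_mul, mul_zero, add_zero, Real.exp_zero, mul_one] at this
    rw [e1]
    have e3 := Real.exp_le_exp.2 e2
    linarith
  calc orliczModular r f μ (m * c) ≤ ∫⁻ x, ENNReal.ofReal m⁻¹ *
        ENNReal.ofReal (Real.exp ((|f x| / c) ^ r) - 1) ∂μ := lintegral_mono key
    _ = ENNReal.ofReal m⁻¹ * orliczModular r f μ c := lintegral_const_mul' _ _ ENNReal.ofReal_ne_top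
    _ ≤ ENNReal.ofReal m⁻¹ * ENNReal.ofReal m := by gcongr
    _ = 1 := by rw [← ENNReal.ofReal_mul (by positivity), inv_mul_cancel₀ hm0.ne', ENNReal.ofReal_one]

/-- The Orlicz heart consists of the functions whose `r`-th power has all exponential moments. -/
lemma memOrliczHeart_iff [IsProbabilityMeasure μ] {r : ℝ} (hr : 1 ≤ r) {f : S → ℝ} :
    MemOrliczHeart r f μ ↔
      Measurable f ∧ ∀ k : ℝ, 0 < k → expMoment μ (fun x => k * |f x| ^ r) < ∞ := by
  have hr0 : 0 < r := by linarith
  constructor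
  · rintro ⟨⟨hf, -⟩, h⟩
    refine ⟨hf, fun k hk => ?_⟩
    have hc : 0 < k ^ (-r⁻¹) := by positivity
    have h2 := orliczModular_add_one (μ := μ) (r := r) (f := f) hc
    have h3 : expMoment μ (fun x => k * |f x| ^ r) =
        expMoment μ (fun x => (|f x| / k ^ (-r⁻¹)) ^ r) := by
      congr 1; ext x
      rw [Real.div_rpow (abs_nonneg _) hc.le, ← Real.rpow_mul hk.le, neg_mul,
        inv_mul_cancel₀ hr0.ne', Real.rpow_neg_one, div_inv_eq_mul, mul_comm]
    rw [h3, ← h2]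
    exact ENNReal.add_lt_top.2 ⟨h _ hc, ENNReal.one_lt_top⟩
  · rintro ⟨hf, h⟩
    have hfin : ∀ c : ℝ, 0 < c → orliczModular r f μ c < ∞ := by
      intro c hc
      have h2 := orliczModular_add_one (μ := μ) (r := r) (f := f) hc
      refine lt_of_le_of_lt le_self_add (h2.trans_lt ?_)
      convert h (c⁻¹ ^ r) (by positivity) using 4 with x
      rw [div_eq_mul_inv, Real.mul_rpow (abs_nonneg _) (by positivity), mul_comm]
    refine ⟨⟨hf, ?_⟩, hfin⟩
    refine lt_of_le_of_lt (luxNorm_le_of_modular_le hr one_pos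
      (m := max 1 (orliczModular r f μ 1).toReal) (le_max_left _ _) ?_) ENNReal.ofReal_lt_top
    rw [← ENNReal.ofReal_toReal (hfin 1 one_pos).ne]
    exact ENNReal.ofReal_le_ofReal (by rw [ENNReal.toReal_ofReal ENNReal.toReal_nonneg]; exact le_max_right _ _)

lemma le_one_add_rpow {t r : ℝ} (ht : 0 ≤ t) (hr : 1 ≤ r) : t ≤ 1 + t ^ r := by
  rcases le_total t 1 with h | h
  · linarith [Real.rpow_nonneg ht r]
  · have := Real.self_le_rpow_of_one_le h hr
    linarith

/-- Uniqueness and rates need only these linear exponential moments; the power `r` itself matters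
for existence. -/
lemma MemOrliczHeart.hasExpMoments [IsProbabilityMeasure μ] {r : ℝ} (hr : 1 ≤ r) {f : S → ℝ}
    (h : MemOrliczHeart r f μ) : HasExpMoments μ f := by
  obtain ⟨hf, hm⟩ := (memOrliczHeart_iff hr).1 h
  refine ⟨hf, fun k => ?_⟩
  have h1 : expMoment μ (fun x => k * f x) ≤
      ENNReal.ofReal (Real.exp 1) * expMoment μ (fun x => ((|k| + 1) ^ r) * |f x| ^ r) := by
    unfold expMoment
    rw [← lintegral_const_mul' _ _ ENNReal.ofReal_ne_top]
    refine lintegral_mono fun x => ?_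
    rw [← ENNReal.ofReal_mul (Real.exp_nonneg _), ← Real.exp_add]
    refine ENNReal.ofReal_le_ofReal (Real.exp_le_exp.2 ?_)
    beta_reduce
    rw [← Real.mul_rpow (by positivity) (abs_nonneg _)]
    refine le_trans ?_ (le_one_add_rpow (by positivity) hr)
    calc k * f x ≤ |k * f x| := le_abs_self _
      _ = |k| * |f x| := abs_mul _ _
      _ ≤ (|k| + 1) * |f x| := by gcongr; linarith
  exact h1.trans_lt (ENNReal.mul_lt_top ENNReal.ofReal_lt_top (hm _ (by positivity)))

lemma expMoment_abs_div_le_two [IsProbabilityMeasure μ] {f : S → ℝ} {c : ℝ}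
    (hc : 0 < c) (h : luxNorm 1 f μ < ENNReal.ofReal c) :
    expMoment μ (fun x => |f x| / c) ≤ 2 := by
  have h1 := orliczModular_le_one_of_luxNorm_lt zero_le_one h
  have h2 := orliczModular_add_one (μ := μ) (r := 1) (f := f) hc
  simp only [Real.rpow_one] at h2
  rw [← h2, ← one_add_one_eq_two]
  gcongr

lemma luxNorm_one_le_of_expMoment_le [IsProbabilityMeasure μ] {f : S → ℝ}
    {c m : ℝ} (hc : 0 < c) (hm : 1 ≤ m)
    (h : expMoment μ (fun x => |f x| / c) ≤ ENNReal.ofReal m) :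
    luxNorm 1 f μ ≤ ENNReal.ofReal (m * c) := by
  refine luxNorm_le_of_modular_le le_rfl hc hm (le_trans ?_ h)
  have h2 := orliczModular_add_one (μ := μ) (r := 1) (f := f) hc
  simp only [Real.rpow_one] at h2
  rw [← h2]; exact le_self_add

end Orlicz

end

end RobustCV

namespace RobustCV

noncomputable section

/-! ### Logarithmic-exponential operators of a kernel -/

variable {X : Type*} [MeasurableSpace X]

/-- The operator `f ↦ β log ∫ exp(f(y) + U(x, y)) K(dy|x)`. -/
def logExpOp (β : ℝ) (U : X × X → ℝ) (K : Kernel X X) (f : X → ℝ) (x : X) : ℝ :=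
  β * Real.log (expMoment (K x) fun y => f y + U (x, y)).toReal

section Kernel

variable {K : Kernel X X} [IsMarkovKernel K] {μ : Measure X} [IsProbabilityMeasure μ]

lemma measurable_expMoment_kernel {g : X × X → ℝ} (hg : Measurable g) :
    Measurable fun x => expMoment (K x) fun y => g (x, y) :=
  (measurable_ofReal_exp hg).lintegral_kernel_prod_right'

lemma measurable_logExpOp {β : ℝ} {U : X × X → ℝ} {f : X → ℝ} (hU : Measurable U)
    (hf : Measurable f) : Measurable (logExpOp β U K f) := by
  have := measurable_expMoment_kernel (K := K) (g := fun z => f z.2 + U z) (by fun_prop)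
  unfold logExpOp
  fun_prop

lemma expMoment_compProd {g : X × X → ℝ} (hg : Measurable g) :
    expMoment (μ ⊗ₘ K) g = ∫⁻ x, expMoment (K x) (fun y => g (x, y)) ∂μ := by
  unfold expMoment
  rw [Measure.lintegral_compProd (measurable_ofReal_exp hg)]

lemma ae_expMoment_kernel_lt_top {g : X × X → ℝ} (hg : Measurable g)
    (h : expMoment (μ ⊗ₘ K) g < ∞) : ∀ᵐ x ∂μ, expMoment (K x) (fun y => g (x, y)) < ∞ := by
  rw [expMoment_compProd hg] at h
  exact ae_lt_top (measurable_expMoment_kernel hg) h.ne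

lemma lintegral_comp_fst {f : X → ℝ≥0∞} (hf : Measurable f) :
    ∫⁻ z, f z.1 ∂(μ ⊗ₘ K) = ∫⁻ x, f x ∂μ := by
  rw [Measure.lintegral_compProd (f := fun z => f z.1) (hf.comp measurable_fst)]
  simp

omit [IsMarkovKernel K] [IsProbabilityMeasure μ] in
lemma lintegral_lintegral_invariant (hK : Kernel.Invariant K μ) {f : X → ℝ≥0∞}
    (hf : Measurable f) : ∫⁻ x, ∫⁻ y, f y ∂(K x) ∂μ = ∫⁻ x, f x ∂μ := by
  conv_rhs => rw [← hK.def]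
  rw [Measure.lintegral_bind K.measurable.aemeasurable hf.aemeasurable]

lemma lintegral_comp_snd (hK : Kernel.Invariant K μ) {f : X → ℝ≥0∞} (hf : Measurable f) :
    ∫⁻ z, f z.2 ∂(μ ⊗ₘ K) = ∫⁻ x, f x ∂μ := by
  rw [Measure.lintegral_compProd (f := fun z => f z.2) (hf.comp measurable_snd),
    ← lintegral_lintegral_invariant hK hf]

lemma expMoment_comp_fst {f : X → ℝ} (hf : Measurable f) :
    expMoment (μ ⊗ₘ K) (fun z => f z.1) = expMoment μ f :=
  lintegral_comp_fst (measurable_ofReal_exp hf)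

lemma expMoment_comp_snd (hK : Kernel.Invariant K μ) {f : X → ℝ} (hf : Measurable f) :
    expMoment (μ ⊗ₘ K) (fun z => f z.2) = expMoment μ f :=
  lintegral_comp_snd hK (measurable_ofReal_exp hf)

lemma HasExpMoments.comp_fst {f : X → ℝ} (hf : HasExpMoments μ f) :
    HasExpMoments (μ ⊗ₘ K) (fun z => f z.1) :=
  ⟨hf.1.comp measurable_fst, fun k => by
    rw [expMoment_comp_fst (f := fun x => k * f x) (hf.1.const_mul k)]; exact hf.2 k⟩

lemma HasExpMoments.comp_snd (hK : Kernel.Invariant K μ) {f : X → ℝ} (hf : HasExpMoments μ f) :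
    HasExpMoments (μ ⊗ₘ K) (fun z => f z.2) :=
  ⟨hf.1.comp measurable_snd, fun k => by
    rw [expMoment_comp_snd hK (f := fun x => k * f x) (hf.1.const_mul k)]; exact hf.2 k⟩

/-! ### A priori bound and extrapolation. -/

/-- An a priori bound for approximate subsolutions of the recursion. -/
lemma expMoment_le_of_subsolution (hK : Kernel.Invariant K μ) {β : ℝ} (hβ₀ : 0 < β) (hβ₁ : β < 1)
    {V : X × X → ℝ} (hV : Measurable V) {Y : X → ℝ} (hY : Measurable Y)
    (hfin : expMoment μ Y < ∞)
    (hsub : ∀ᵐ x ∂μ, ENNReal.ofReal (Real.exp (Y x)) ≤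
      expMoment (K x) fun y => β * Y y + V (x, y)) :
    expMoment μ Y ≤ expMoment (μ ⊗ₘ K) fun z => V z / (1 - β) := by
  have h1β : 0 < 1 - β := by linarith
  set A := expMoment μ Y with hA
  set B := expMoment (μ ⊗ₘ K) fun z => V z / (1 - β) with hB
  -- AM-GM gives `exp(βY + V) ≤ β exp(Y) + (1 - β) exp(V / (1 - β))`, and stationarity turns the
  -- integral of `exp(Y(y))` back into `A`. As `A` is finite, `βA` can then be absorbed.
  have h1 : A ≤ ENNReal.ofReal β * A + ENNReal.ofReal (1 - β) * B := by
    calc A ≤ ∫⁻ x, expMoment (K x) (fun y => β * Y y + V (x, y)) ∂μ := lintegral_mono_ae hsub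
      _ = expMoment (μ ⊗ₘ K) fun z => β * Y z.2 + V z :=
        (expMoment_compProd (g := fun z : X × X => β * Y z.2 + V z) (by fun_prop)).symm
      _ ≤ ∫⁻ z, (ENNReal.ofReal β * ENNReal.ofReal (Real.exp (Y z.2)) +
            ENNReal.ofReal (1 - β) * ENNReal.ofReal (Real.exp (V z / (1 - β)))) ∂(μ ⊗ₘ K) := by
          refine lintegral_mono fun z => ?_
          refine le_trans (le_of_eq ?_) (ofReal_exp_convex hβ₀.le hβ₁.le _ _)
          congr 3; field_simp
      _ = _ := by
          rw [lintegral_add_left (by fun_prop), lintegral_const_mul _ (by fun_prop),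
            lintegral_const_mul _ (by fun_prop)]
          congr 2
          exact expMoment_comp_snd hK hY
  by_cases hBt : B = ∞
  · rw [hBt]; exact le_top
  · have h2 : A.toReal ≤ β * A.toReal + (1 - β) * B.toReal := by
      have := ENNReal.toReal_mono (ENNReal.add_ne_top.2
        ⟨ENNReal.mul_ne_top ENNReal.ofReal_ne_top hfin.ne,
          ENNReal.mul_ne_top ENNReal.ofReal_ne_top hBt⟩) h1
      rwa [ENNReal.toReal_add (ENNReal.mul_ne_top ENNReal.ofReal_ne_top hfin.ne)
        (ENNReal.mul_ne_top ENNReal.ofReal_ne_top hBt), ENNReal.toReal_mul, ENNReal.toReal_mul,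
        ENNReal.toReal_ofReal hβ₀.le, ENNReal.toReal_ofReal h1β.le] at this
    rw [← ENNReal.toReal_le_toReal hfin.ne hBt]
    nlinarith

/-- Inverting the logarithm requires a finite moment: where it is infinite, `toReal` and `Real.log`
default to `0` and the equation for `logExpOp` carries no information. -/
lemma ae_expMoment_eq_of_logExpOp (hK : Kernel.Invariant K μ) {β : ℝ} (hβ₀ : 0 < β)
    {U : X × X → ℝ} (hU : Measurable U) (hU2 : expMoment (μ ⊗ₘ K) (fun z => 2 * U z) < ∞)
    {f d : X → ℝ} (hf : HasExpMoments μ f) (hd : ∀ᵐ x ∂μ, logExpOp β U K f x = f x + d x) :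
    ∀ᵐ x ∂μ, expMoment (K x) (fun y => f y + U (x, y)) =
      ENNReal.ofReal (Real.exp ((f x + d x) / β)) := by
  have hfm := hf.1
  have hfin : expMoment (μ ⊗ₘ K) (fun z => f z.2 + U z) < ∞ := by
    refine lt_of_le_of_lt ?_ (ENNReal.add_lt_top.2 ⟨(hf.comp_snd hK).2 2, hU2⟩)
    refine le_trans (le_of_eq ?_) (expMoment_half_add_le (by fun_prop))
    congr 1; ext z; ring
  filter_upwards [ae_expMoment_kernel_lt_top (by fun_prop) hfin, hd] with x hx hdx
  have hpos : 0 < expMoment (K x) (fun y => f y + U (x, y)) := expMoment_pos (by fun_prop)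
  rw [← hdx, logExpOp, mul_div_cancel_left₀ _ hβ₀.ne',
    Real.exp_log (ENNReal.toReal_pos hpos.ne' hx.ne), ENNReal.ofReal_toReal hx.ne]

omit [IsMarkovKernel K] in
/-- Extrapolating beyond an approximate fixed point yields an approximate subsolution, because
the operator is convex. -/
lemma extrapolation_subsolution {U : X × X → ℝ} (hU : Measurable U)
    {f₀ f₁ : X → ℝ} (hf₀ : Measurable f₀) (hf₁ : Measurable f₁) {t : ℝ} (ht : 0 ≤ t) {x : X}
    {a b : ℝ} (h₀ : expMoment (K x) (fun y => f₀ y + U (x, y)) = ENNReal.ofReal (Real.exp a))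
    (h₁ : expMoment (K x) (fun y => f₁ y + U (x, y)) = ENNReal.ofReal (Real.exp b)) :
    ENNReal.ofReal (Real.exp ((1 + t) * a - t * b)) ≤
      expMoment (K x) fun y => ((1 + t) * f₀ y - t * f₁ y) + U (x, y) := by
  have h1t : 0 < 1 + t := by linarith
  set I := expMoment (K x) fun y => ((1 + t) * f₀ y - t * f₁ y) + U (x, y) with hI
  -- Hölder with `f₀` as the combination of the extrapolation and `f₁`, weights `1 / (1 + t)` and `t
  -- / (1 + t)`. An upper bound for the moment of `f₀` is a lower bound for `I`.
  have h := expMoment_convex (μ := K x) (f := fun y => ((1 + t) * f₀ y - t * f₁ y) + U (x, y))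
    (g := fun y => f₁ y + U (x, y)) (by fun_prop) (by fun_prop) (p := 1 / (1 + t))
    (q := t / (1 + t)) (by positivity) (by positivity) (by field_simp)
  have e : (fun y => 1 / (1 + t) * (((1 + t) * f₀ y - t * f₁ y) + U (x, y)) +
      t / (1 + t) * (f₁ y + U (x, y))) = fun y => f₀ y + U (x, y) := by
    ext y; field_simp; ring
  rw [e, h₀, h₁, ← hI, ENNReal.ofReal_rpow_of_pos (Real.exp_pos _), ← Real.exp_mul] at h
  rw [← ENNReal.rpow_le_rpow_iff (z := 1 / (1 + t)) (by positivity),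
    ENNReal.ofReal_rpow_of_pos (Real.exp_pos _), ← Real.exp_mul]
  have e2 : ((1 + t) * a - t * b) * (1 / (1 + t)) = a + -(b * (t / (1 + t))) := by
    field_simp; ring
  rw [e2, Real.exp_add, ENNReal.ofReal_mul (Real.exp_nonneg _)]
  calc ENNReal.ofReal (Real.exp a) * ENNReal.ofReal (Real.exp (-(b * (t / (1 + t)))))
      ≤ (I ^ (1 / (1 + t)) * ENNReal.ofReal (Real.exp (b * (t / (1 + t))))) *
          ENNReal.ofReal (Real.exp (-(b * (t / (1 + t))))) := by gcongr
    _ = I ^ (1 / (1 + t)) := by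
      rw [mul_assoc, ← ENNReal.ofReal_mul (Real.exp_nonneg _), ← Real.exp_add]
      simp

/-- The extrapolation `(1 + t) f₀ - t f₁` of approximate fixed points has an exponential moment
bounded in terms of the approximation errors. -/
theorem extrapolation_bound (hK : Kernel.Invariant K μ) {β : ℝ} (hβ₀ : 0 < β) (hβ₁ : β < 1)
    {U : X × X → ℝ} (hU : Measurable U) (hU2 : expMoment (μ ⊗ₘ K) (fun z => 2 * U z) < ∞)
    {f₀ f₁ d₀ d₁ : X → ℝ} (hf₀ : HasExpMoments μ f₀) (hf₁ : HasExpMoments μ f₁)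
    (hd₀ : Measurable d₀) (hd₁ : Measurable d₁)
    (h₀ : ∀ᵐ x ∂μ, logExpOp β U K f₀ x = f₀ x + d₀ x)
    (h₁ : ∀ᵐ x ∂μ, logExpOp β U K f₁ x = f₁ x + d₁ x) {t : ℝ} (ht : 0 ≤ t) :
    expMoment μ (fun x => ((1 + t) * f₀ x - t * f₁ x) / β) ≤
      expMoment (μ ⊗ₘ K) fun z => (U z - ((1 + t) * d₀ z.1 - t * d₁ z.1) / β) / (1 - β) := by
  have hfm₀ := hf₀.1
  have hfm₁ := hf₁.1
  refine expMoment_le_of_subsolution hK hβ₀ hβ₁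
    (V := fun z => U z - ((1 + t) * d₀ z.1 - t * d₁ z.1) / β) (by fun_prop)
    (Y := fun x => ((1 + t) * f₀ x - t * f₁ x) / β) (by fun_prop) ?_ ?_
  · have := (((hf₀.const_mul (1 + t)).sub (hf₁.const_mul t)).2 (β⁻¹))
    simpa only [div_eq_inv_mul] using this
  · filter_upwards [ae_expMoment_eq_of_logExpOp hK hβ₀ hU hU2 hf₀ h₀,
      ae_expMoment_eq_of_logExpOp hK hβ₀ hU hU2 hf₁ h₁] with x hx₀ hx₁
    have h := extrapolation_subsolution hU hfm₀ hfm₁ ht hx₀ hx₁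
    set e := ((1 + t) * d₀ x - t * d₁ x) / β with he
    calc ENNReal.ofReal (Real.exp (((1 + t) * f₀ x - t * f₁ x) / β))
        = ENNReal.ofReal (Real.exp (-e)) * ENNReal.ofReal
            (Real.exp ((1 + t) * ((f₀ x + d₀ x) / β) - t * ((f₁ x + d₁ x) / β))) := by
          rw [← ENNReal.ofReal_mul (Real.exp_nonneg _), ← Real.exp_add]
          congr 2; rw [he]; field_simp; ring
      _ ≤ ENNReal.ofReal (Real.exp (-e)) *
            expMoment (K x) fun y => ((1 + t) * f₀ y - t * f₁ y) + U (x, y) := by gcongr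
      _ = _ := by
          unfold expMoment
          rw [← lintegral_const_mul' _ _ ENNReal.ofReal_ne_top]
          refine lintegral_congr fun y => ?_
          rw [← ENNReal.ofReal_mul (Real.exp_nonneg _), ← Real.exp_add]
          congr 2; field_simp; ring

/-! ### Uniqueness of fixed points. -/

/-- Fixed points with exponential moments are ordered, hence unique. -/
lemma fixedPt_ae_le (hK : Kernel.Invariant K μ) {β : ℝ} (hβ₀ : 0 < β) (hβ₁ : β < 1)
    {U : X × X → ℝ} (hU : HasExpMoments (μ ⊗ₘ K) U)
    {f g : X → ℝ} (hf : HasExpMoments μ f) (hg : HasExpMoments μ g)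
    (hf' : logExpOp β U K f =ᵐ[μ] f) (hg' : logExpOp β U K g =ᵐ[μ] g) : f ≤ᵐ[μ] g := by
  have hfm := hf.1
  have hgm := hg.1
  set B := expMoment (μ ⊗ₘ K) fun z => U z / (1 - β) with hB
  have hBt : B < ∞ := by
    have := hU.2 (1 - β)⁻¹
    simpa only [hB, div_eq_inv_mul] using this
  -- Zero residuals make the bound independent of `t = n`. The integrand tends to infinity wherever
  -- `f > g`, so Fatou's lemma makes that set null.
  have hbd : ∀ n : ℕ, ∫⁻ x, ENNReal.ofReal (Real.exp (f x / β)) *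
      ENNReal.ofReal (Real.exp ((f x - g x) / β)) ^ n ∂μ ≤ B := by
    intro n
    have h := extrapolation_bound hK hβ₀ hβ₁ hU.1 (hU.2 2) hf hg (d₀ := fun _ => 0)
      (d₁ := fun _ => 0) measurable_const measurable_const
      (by filter_upwards [hf'] with x hx; simpa using hx)
      (by filter_upwards [hg'] with x hx; simpa using hx) (t := n) (Nat.cast_nonneg n)
    simp only [mul_zero, sub_zero, zero_div] at h
    refine le_trans (le_of_eq (lintegral_congr fun x => ?_)) h
    rw [← ENNReal.ofReal_pow (Real.exp_nonneg _), ← Real.exp_nat_mul,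
      ← ENNReal.ofReal_mul (Real.exp_nonneg _), ← Real.exp_add]
    congr 2; field_simp; ring
  have hmeas : Measurable fun x => liminf (fun n : ℕ => ENNReal.ofReal (Real.exp (f x / β)) *
      ENNReal.ofReal (Real.exp ((f x - g x) / β)) ^ n) atTop :=
    Measurable.liminf fun n => by fun_prop
  have hlim := lintegral_liminf_le (μ := μ) (u := atTop) (f := fun (n : ℕ) x =>
    ENNReal.ofReal (Real.exp (f x / β)) * ENNReal.ofReal (Real.exp ((f x - g x) / β)) ^ n)
    (fun n => by fun_prop)
  have hlt := lt_of_le_of_lt (hlim.trans (liminf_le_of_le (a := B) (by isBoundedDefault)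
    (fun b hb => by
      obtain ⟨n, hn⟩ := hb.exists
      exact hn.trans (hbd n)))) hBt
  filter_upwards [ae_lt_top hmeas hlt.ne] with x hx
  by_contra hlt
  push Not at hlt
  have h1 : (1 : ℝ≥0∞) < ENNReal.ofReal (Real.exp ((f x - g x) / β)) := by
    rw [← ENNReal.ofReal_one, ENNReal.ofReal_lt_ofReal_iff (Real.exp_pos _)]
    exact Real.one_lt_exp_iff.2 (div_pos (sub_pos.2 hlt) hβ₀)
  have h2 := ENNReal.Tendsto.const_mul (a := ENNReal.ofReal (Real.exp (f x / β)))
    (ENNReal.tendsto_pow_atTop_nhds_top_iff.2 h1) (Or.inl ENNReal.top_ne_zero)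
  rw [ENNReal.mul_top (by simp [Real.exp_pos])] at h2
  rw [h2.liminf_eq] at hx
  exact lt_irrefl _ hx

theorem fixedPt_ae_eq (hK : Kernel.Invariant K μ) {β : ℝ} (hβ₀ : 0 < β) (hβ₁ : β < 1)
    {U : X × X → ℝ} (hU : HasExpMoments (μ ⊗ₘ K) U)
    {f g : X → ℝ} (hf : HasExpMoments μ f) (hg : HasExpMoments μ g)
    (hf' : logExpOp β U K f =ᵐ[μ] f) (hg' : logExpOp β U K g =ᵐ[μ] g) : f =ᵐ[μ] g :=
  (fixedPt_ae_le hK hβ₀ hβ₁ hU hf hg hf' hg').antisymm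
    (fixedPt_ae_le hK hβ₀ hβ₁ hU hg hf hg' hf')

end Kernel

end

end RobustCV

namespace RobustCV

noncomputable section

/-! ### A convex majorant of the exponential of a power of the logarithm -/

/-- The supremum of the tangents `z ↦ exp(-k (r - 1) s ^ r) z ^ (k r s ^ (r - 1))`, `1 ≤ s`, which
represents `exp(k (log z) ^ r)` for `z ≥ e`. -/
def expPowLog (k r : ℝ) (z : ℝ≥0∞) : ℝ≥0∞ :=
  ⨆ (s : ℝ) (_ : 1 ≤ s),
    ENNReal.ofReal (Real.exp (-(k * (r - 1) * s ^ r))) * z ^ (k * r * s ^ (r - 1))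

/-- Each member of the family is a constant times a power with exponent at least one. Monotonicity,
Jensen, Young and passage to suprema are therefore checked member by member and inherited by the
supremum. -/
lemma expPowLog_exponent_ge {k r s : ℝ} (hk : 1 ≤ k) (hr : 1 < r) (hs : 1 ≤ s) :
    1 ≤ k * r * s ^ (r - 1) :=
  one_le_mul_of_one_le_of_one_le (one_le_mul_of_one_le_of_one_le hk hr.le)
    (Real.one_le_rpow hs (by linarith))

lemma measurable_expPowLog (k r : ℝ) : Measurable (expPowLog k r) := by
  apply LowerSemicontinuous.measurable
  refine lowerSemicontinuous_iSup fun s => lowerSemicontinuous_iSup fun _ => ?_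
  exact ((ENNReal.continuous_const_mul ENNReal.ofReal_ne_top).comp
    ENNReal.continuous_rpow_const).lowerSemicontinuous

lemma expPowLog_mono {k r : ℝ} (hk : 1 ≤ k) (hr : 1 < r) : Monotone (expPowLog k r) := by
  intro z w h
  refine iSup₂_mono fun s hs => ?_
  have := expPowLog_exponent_ge hk hr hs
  gcongr

/-- Young's inequality `r t s ^ (r - 1) ≤ t ^ r + (r - 1) s ^ r`. Equality at `s = t` gives the
converse below, for `t ≥ 1` because only `s ≥ 1` is admitted; for `t < 1` the loss is at most the
constant `exp k`. -/
lemma expPowLog_exp_le {k r t : ℝ} (hk : 1 ≤ k) (hr : 1 < r) (ht : 0 ≤ t) :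
    expPowLog k r (ENNReal.ofReal (Real.exp t)) ≤ ENNReal.ofReal (Real.exp (k * t ^ r)) := by
  refine iSup₂_le fun s hs => ?_
  rw [ENNReal.ofReal_rpow_of_pos (Real.exp_pos _), ← Real.exp_mul,
    ← ENNReal.ofReal_mul (Real.exp_nonneg _), ← Real.exp_add]
  refine ENNReal.ofReal_le_ofReal (Real.exp_le_exp.2 ?_)
  have hs0 : 0 ≤ s := by linarith
  have hr1 : 0 < r - 1 := by linarith
  have hr0 : 0 < r := by linarith
  have hpq : r.HolderConjugate (r / (r - 1)) := Real.HolderConjugate.conjExponent hr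
  have hy := Real.young_inequality_of_nonneg ht (Real.rpow_nonneg hs0 (r - 1)) hpq
  rw [← Real.rpow_mul hs0, mul_div_cancel₀ _ hr1.ne'] at hy
  have e : s ^ r / (r / (r - 1)) = (r - 1) * s ^ r / r := by field_simp
  rw [e, ← add_div, le_div_iff₀ hr0] at hy
  nlinarith

lemma expPowLog_exp_ge {k r t : ℝ} (ht : 1 ≤ t) :
    ENNReal.ofReal (Real.exp (k * t ^ r)) ≤ expPowLog k r (ENNReal.ofReal (Real.exp t)) := by
  refine le_iSup₂_of_le t ht ?_
  rw [ENNReal.ofReal_rpow_of_pos (Real.exp_pos _), ← Real.exp_mul,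
    ← ENNReal.ofReal_mul (Real.exp_nonneg _), ← Real.exp_add]
  refine le_of_eq ?_
  have : t ^ r = t ^ (r - 1) * t := by
    rw [← Real.rpow_add_one (by linarith)]; congr 1; ring
  rw [this]; congr 2; ring

lemma exp_le_add_expPowLog {k r t : ℝ} (hk : 1 ≤ k) (hr : 1 < r) (ht : 0 ≤ t) :
    ENNReal.ofReal (Real.exp (k * t ^ r)) ≤
      ENNReal.ofReal (Real.exp k) + expPowLog k r (ENNReal.ofReal (Real.exp t)) := by
  rcases le_total 1 t with h | h
  · exact (expPowLog_exp_ge h).trans le_add_self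
  · refine le_trans (ENNReal.ofReal_le_ofReal (Real.exp_le_exp.2 ?_)) le_self_add
    have := Real.rpow_le_one ht h (by linarith : 0 ≤ r)
    nlinarith

lemma expPowLog_top {k r : ℝ} (hk : 1 ≤ k) (hr : 1 < r) : expPowLog k r ∞ = ∞ := by
  rw [eq_top_iff]
  refine le_iSup₂_of_le 1 le_rfl ?_
  have := expPowLog_exponent_ge hk hr le_rfl
  rw [ENNReal.top_rpow_of_pos (by linarith), ENNReal.mul_top (by simp [Real.exp_pos])]

lemma expPowLog_iSup_le {k r : ℝ} (hk : 1 ≤ k) (hr : 1 < r) (z : ℕ → ℝ≥0∞) :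
    expPowLog k r (⨆ n, z n) ≤ ⨆ n, expPowLog k r (z n) := by
  refine iSup₂_le fun s hs => ?_
  have hm := expPowLog_exponent_ge hk hr hs
  have h1 : (⨆ n, z n) ^ (k * r * s ^ (r - 1)) = ⨆ n, z n ^ (k * r * s ^ (r - 1)) :=
    (ENNReal.orderIsoRpow _ (by linarith)).map_iSup z
  rw [h1, ENNReal.mul_iSup]
  refine iSup_mono fun n => ?_
  exact le_iSup₂_of_le (f := fun (s : ℝ) (_ : 1 ≤ s) => ENNReal.ofReal
    (Real.exp (-(k * (r - 1) * s ^ r))) * z n ^ (k * r * s ^ (r - 1))) s hs le_rfl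

lemma rpow_lintegral_le {S : Type*} [MeasurableSpace S] {ν : Measure S} [IsProbabilityMeasure ν]
    {Z : S → ℝ≥0∞} (hZ : Measurable Z) {m : ℝ} (hm : 1 ≤ m) :
    (∫⁻ x, Z x ∂ν) ^ m ≤ ∫⁻ x, Z x ^ m ∂ν := by
  have hm0 : 0 < m := by linarith
  have h := ENNReal.lintegral_mul_norm_pow_le (μ := ν) (f := fun x => Z x ^ m) (g := fun _ => 1)
    (hZ.pow_const m).aemeasurable aemeasurable_const (p := m⁻¹) (q := 1 - m⁻¹) (by positivity)
    (by linarith [inv_le_one_of_one_le₀ hm]) (by ring)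
  simp only [ENNReal.one_rpow, mul_one, lintegral_one, measure_univ] at h
  have e : ∀ x, (Z x ^ m) ^ m⁻¹ = Z x := fun x => by
    rw [← ENNReal.rpow_mul, mul_inv_cancel₀ hm0.ne', ENNReal.rpow_one]
  simp only [e] at h
  calc (∫⁻ x, Z x ∂ν) ^ m ≤ ((∫⁻ x, Z x ^ m ∂ν) ^ m⁻¹) ^ m := by gcongr
    _ = _ := by rw [← ENNReal.rpow_mul, inv_mul_cancel₀ hm0.ne', ENNReal.rpow_one]

/-- Jensen's inequality for `expPowLog`. -/
lemma expPowLog_lintegral_le {S : Type*} [MeasurableSpace S] {ν : Measure S}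
    [IsProbabilityMeasure ν] {Z : S → ℝ≥0∞} (hZ : Measurable Z) {k r : ℝ} (hk : 1 ≤ k)
    (hr : 1 < r) : expPowLog k r (∫⁻ x, Z x ∂ν) ≤ ∫⁻ x, expPowLog k r (Z x) ∂ν := by
  refine iSup₂_le fun s hs => ?_
  calc _ ≤ ENNReal.ofReal (Real.exp (-(k * (r - 1) * s ^ r))) *
          ∫⁻ x, Z x ^ (k * r * s ^ (r - 1)) ∂ν := by
        gcongr; exact rpow_lintegral_le hZ (expPowLog_exponent_ge hk hr hs)
    _ = ∫⁻ x, ENNReal.ofReal (Real.exp (-(k * (r - 1) * s ^ r))) *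
          Z x ^ (k * r * s ^ (r - 1)) ∂ν := (lintegral_const_mul' _ _ ENNReal.ofReal_ne_top).symm
    _ ≤ _ := lintegral_mono fun x => le_iSup₂_of_le (f := fun (s : ℝ) (_ : 1 ≤ s) =>
        ENNReal.ofReal (Real.exp (-(k * (r - 1) * s ^ r))) * Z x ^ (k * r * s ^ (r - 1)))
        s hs le_rfl

/-- Young's inequality with exponents `1 / β` and `1 / (1 - β)`, applied to each power. The weights
add up to one, so iterating does not inflate the bound. -/
lemma expPowLog_rpow_mul_exp_le {k r β w : ℝ} (hk : 1 ≤ k) (hr : 1 < r) (hβ₀ : 0 < β)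
    (hβ₁ : β < 1) (hw : 0 ≤ w) (z : ℝ≥0∞) :
    expPowLog k r (z ^ β * ENNReal.ofReal (Real.exp w)) ≤ ENNReal.ofReal β * expPowLog k r z +
      ENNReal.ofReal (1 - β) * ENNReal.ofReal (Real.exp (k * (w / (1 - β)) ^ r)) := by
  have h1β : 0 < 1 - β := by linarith
  refine iSup₂_le fun s hs => ?_
  set m := k * r * s ^ (r - 1) with hm
  set c := ENNReal.ofReal (Real.exp (-(k * (r - 1) * s ^ r))) with hc
  have hm1 : 1 ≤ m := expPowLog_exponent_ge hk hr hs
  have hpq : (β⁻¹).HolderConjugate ((1 - β)⁻¹) := by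
    rw [Real.holderConjugate_iff]
    exact ⟨(one_lt_inv₀ hβ₀).2 hβ₁, by simp⟩
  have hy := ENNReal.young_inequality (z ^ (β * m)) (ENNReal.ofReal (Real.exp (w * m))) hpq
  rw [← ENNReal.rpow_mul, ENNReal.ofReal_rpow_of_pos (Real.exp_pos _), ← Real.exp_mul,
    ENNReal.ofReal_inv_of_pos hβ₀, ENNReal.ofReal_inv_of_pos h1β, div_eq_mul_inv, inv_inv,
    div_eq_mul_inv, inv_inv] at hy
  have e1 : β * m * β⁻¹ = m := by field_simp
  have e2 : w * m * (1 - β)⁻¹ = (w / (1 - β)) * m := by field_simp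
  rw [e1, e2, Real.exp_mul (w / (1 - β)), ← ENNReal.ofReal_rpow_of_pos (Real.exp_pos _)] at hy
  calc c * (z ^ β * ENNReal.ofReal (Real.exp w)) ^ m
      = c * (z ^ (β * m) * ENNReal.ofReal (Real.exp (w * m))) := by
        rw [ENNReal.mul_rpow_of_nonneg _ _ (by linarith), ← ENNReal.rpow_mul,
          ENNReal.ofReal_rpow_of_pos (Real.exp_pos _), ← Real.exp_mul]
    _ ≤ c * (z ^ m * ENNReal.ofReal β +
          ENNReal.ofReal (Real.exp (w / (1 - β))) ^ m * ENNReal.ofReal (1 - β)) := by gcongr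
    _ = ENNReal.ofReal β * (c * z ^ m) + ENNReal.ofReal (1 - β) *
          (c * ENNReal.ofReal (Real.exp (w / (1 - β))) ^ m) := by ring
    _ ≤ _ := by
        gcongr
        · exact le_iSup₂_of_le (f := fun (s : ℝ) (_ : 1 ≤ s) =>
            ENNReal.ofReal (Real.exp (-(k * (r - 1) * s ^ r))) * z ^ (k * r * s ^ (r - 1)))
            s hs le_rfl
        · refine le_trans ?_ (expPowLog_exp_le hk hr (by positivity))
          exact le_iSup₂_of_le (f := fun (s : ℝ) (_ : 1 ≤ s) =>
            ENNReal.ofReal (Real.exp (-(k * (r - 1) * s ^ r))) *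
              ENNReal.ofReal (Real.exp (w / (1 - β))) ^ (k * r * s ^ (r - 1))) s hs le_rfl

/-! ### Existence of fixed points -/

variable {X : Type*} [MeasurableSpace X]

/-- The exponential form `G ↦ ∫ G(y) ^ β exp(W(x, y)) K(dy|x)` of the recursion. -/
def powStep (β : ℝ) (W : X × X → ℝ) (K : Kernel X X) (G : X → ℝ≥0∞) (x : X) : ℝ≥0∞ :=
  ∫⁻ y, G y ^ β * ENNReal.ofReal (Real.exp (W (x, y))) ∂(K x)

section Existence

variable {K : Kernel X X} [IsMarkovKernel K] {μ : Measure X} [IsProbabilityMeasure μ]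

lemma measurable_powStep {β : ℝ} {W : X × X → ℝ} (hW : Measurable W) {G : X → ℝ≥0∞}
    (hG : Measurable G) : Measurable (powStep β W K G) :=
  Measurable.lintegral_kernel_prod_right'
    (f := fun z : X × X => G z.2 ^ β * ENNReal.ofReal (Real.exp (W z))) (by fun_prop)

omit [IsMarkovKernel K] in
lemma powStep_mono {β : ℝ} (hβ : 0 ≤ β) (W : X × X → ℝ) : Monotone (powStep β W K) := by
  intro G H h x
  refine lintegral_mono fun y => ?_
  have := h y
  gcongr

lemma measurable_iterate_powStep {β : ℝ} {W : X × X → ℝ} (hW : Measurable W) {G : X → ℝ≥0∞}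
    (hG : Measurable G) (n : ℕ) : Measurable ((powStep β W K)^[n] G) := by
  induction n with
  | zero => exact hG
  | succ n ih => rw [Function.iterate_succ_apply']; exact measurable_powStep hW ih

/-- From a subsolution the iterates increase, and monotone convergence carries the supremum through
the integral. Values in `[0, ∞]` make any finiteness condition superfluous here. -/
lemma powStep_iSup_iterate {β : ℝ} (hβ : 0 < β) {W : X × X → ℝ} (hW : Measurable W)
    {G : X → ℝ≥0∞} (hG : Measurable G) (hsub : G ≤ powStep β W K G) :
    powStep β W K (⨆ n, (powStep β W K)^[n] G) = ⨆ n, (powStep β W K)^[n] G := by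
  have hmono := (powStep_mono (K := K) hβ.le W).monotone_iterate_of_le_map hsub
  have h1 : powStep β W K (⨆ n, (powStep β W K)^[n] G) = ⨆ n, (powStep β W K)^[n + 1] G := by
    ext x
    simp only [iSup_apply, Function.iterate_succ_apply']
    unfold powStep
    rw [← lintegral_iSup]
    · refine lintegral_congr fun y => ?_
      rw [iSup_apply, ← ENNReal.iSup_mul]
      congr 1
      exact (ENNReal.orderIsoRpow β hβ).map_iSup _
    · intro n
      have := measurable_iterate_powStep (K := K) (β := β) hW hG n
      unfold powStep at this
      fun_prop
    · intro n m hnm y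
      have := hmono hnm y
      unfold powStep at this
      beta_reduce
      gcongr
  rw [h1]
  exact hmono.iSup_nat_add 1

/-- Cauchy–Schwarz: the two integrands have product at least one, hence so do the two integrals. If
`H` solves the problem with `|U|`, this makes `1 / H` a subsolution for `U`. -/
lemma inv_powStep_le {β : ℝ} (hβ : 0 < β) {U : X × X → ℝ} (hU : Measurable U) {H : X → ℝ≥0∞}
    (hH : Measurable H) (hH1 : ∀ x, 1 ≤ H x) (x : X) :
    (powStep β (fun z => |U z|) K H x)⁻¹ ≤ powStep β U K (fun y => (H y)⁻¹) x := by
  set A := powStep β (fun z => |U z|) K H x with hA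
  set B := powStep β U K (fun y => (H y)⁻¹) x with hB
  by_cases hAt : A = ∞
  · simp [hAt]
  have hfin : ∀ᵐ y ∂(K x), H y ^ β * ENNReal.ofReal (Real.exp |U (x, y)|) < ∞ :=
    ae_lt_top (by fun_prop) hAt
  have h1 : (1 : ℝ≥0∞) ≤ A ^ (1 / 2 : ℝ) * B ^ (1 / 2 : ℝ) := by
    refine le_trans ?_ (ENNReal.lintegral_mul_norm_pow_le (μ := K x)
      (f := fun y => H y ^ β * ENNReal.ofReal (Real.exp |U (x, y)|))
      (g := fun y => (H y)⁻¹ ^ β * ENNReal.ofReal (Real.exp (U (x, y))))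
      (by fun_prop) (by fun_prop) (by norm_num) (by norm_num) (by norm_num))
    have : (1 : ℝ≥0∞) = ∫⁻ _, 1 ∂(K x) := by simp
    rw [this]
    refine lintegral_mono_ae ?_
    filter_upwards [hfin] with y hy
    rw [← ENNReal.mul_rpow_of_nonneg _ _ (by norm_num)]
    refine ENNReal.one_le_rpow ?_ (by norm_num)
    have hHt : H y ≠ ∞ := by
      rintro h
      rw [h, ENNReal.top_rpow_of_pos hβ, ENNReal.top_mul (by simp [Real.exp_pos])] at hy
      exact lt_irrefl _ hy
    have hH0 : H y ≠ 0 := (zero_lt_one.trans_le (hH1 y)).ne'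
    calc (1 : ℝ≥0∞) ≤ (H y ^ β * (H y)⁻¹ ^ β) *
          (ENNReal.ofReal (Real.exp |U (x, y)|) * ENNReal.ofReal (Real.exp (U (x, y)))) := by
          rw [← ENNReal.mul_rpow_of_nonneg _ _ hβ.le, ENNReal.mul_inv_cancel hH0 hHt,
            ENNReal.one_rpow, one_mul, ← ENNReal.ofReal_mul (Real.exp_nonneg _), ← Real.exp_add,
            ENNReal.one_le_ofReal]
          exact Real.one_le_exp (by linarith [neg_abs_le (U (x, y))])
      _ = _ := by ring
  rw [← ENNReal.mul_rpow_of_nonneg _ _ (by norm_num)] at h1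
  have h2 : 1 ≤ A * B := by
    by_contra h
    push Not at h
    exact absurd h1 (not_le.2 (ENNReal.rpow_lt_one h (by norm_num)))
  have hA0 : A ≠ 0 := by
    rintro h; simp [h] at h2
  calc A⁻¹ = A⁻¹ * 1 := (mul_one _).symm
    _ ≤ A⁻¹ * (A * B) := by gcongr
    _ = B := by rw [← mul_assoc, ENNReal.inv_mul_cancel hA0 hAt, one_mul]

lemma lintegral_expPowLog_powStep_le (hK : Kernel.Invariant K μ) {β : ℝ} (hβ₀ : 0 < β)
    (hβ₁ : β < 1) {U : X × X → ℝ} (hU : Measurable U) {k r : ℝ} (hk : 1 ≤ k) (hr : 1 < r)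
    {G : X → ℝ≥0∞} (hG : Measurable G) :
    ∫⁻ x, expPowLog k r (powStep β (fun z => |U z|) K G x) ∂μ ≤
      ENNReal.ofReal β * ∫⁻ x, expPowLog k r (G x) ∂μ + ENNReal.ofReal (1 - β) *
        expMoment (μ ⊗ₘ K) fun z => k * (|U z| / (1 - β)) ^ r := by
  have hΦ := measurable_expPowLog k r
  calc _ ≤ ∫⁻ x, ∫⁻ y, expPowLog k r (G y ^ β * ENNReal.ofReal (Real.exp |U (x, y)|)) ∂(K x) ∂μ :=
        lintegral_mono fun x => expPowLog_lintegral_le (by fun_prop) hk hr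
    _ = ∫⁻ z, expPowLog k r (G z.2 ^ β * ENNReal.ofReal (Real.exp |U z|)) ∂(μ ⊗ₘ K) := by
        rw [Measure.lintegral_compProd]
        exact hΦ.comp (by fun_prop)
    _ ≤ ∫⁻ z, (ENNReal.ofReal β * expPowLog k r (G z.2) + ENNReal.ofReal (1 - β) *
          ENNReal.ofReal (Real.exp (k * (|U z| / (1 - β)) ^ r))) ∂(μ ⊗ₘ K) :=
        lintegral_mono fun z => expPowLog_rpow_mul_exp_le hk hr hβ₀ hβ₁ (abs_nonneg _) _
    _ = _ := by
        rw [lintegral_add_right _ (by fun_prop), lintegral_const_mul' _ _ ENNReal.ofReal_ne_top,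
          lintegral_const_mul' _ _ ENNReal.ofReal_ne_top,
          lintegral_comp_snd hK (f := fun y => expPowLog k r (G y)) (hΦ.comp hG)]
        rfl

/-- The previous estimate is a convex combination of the old bound and the moment `B` of `|U|`, so
`1 + B` is preserved; the start `G = 1` contributes at most `1`. -/
lemma lintegral_expPowLog_iterate_le (hK : Kernel.Invariant K μ) {β : ℝ} (hβ₀ : 0 < β)
    (hβ₁ : β < 1) {U : X × X → ℝ} (hU : Measurable U) {k r : ℝ} (hk : 1 ≤ k) (hr : 1 < r)
    (n : ℕ) :
    ∫⁻ x, expPowLog k r ((powStep β (fun z => |U z|) K)^[n] 1 x) ∂μ ≤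
      1 + expMoment (μ ⊗ₘ K) fun z => k * (|U z| / (1 - β)) ^ r := by
  have hr0 : r ≠ 0 := by linarith
  induction n with
  | zero =>
    refine le_trans ?_ le_self_add
    have h := expPowLog_exp_le (t := 0) hk hr le_rfl
    simp only [Real.exp_zero, ENNReal.ofReal_one, Real.zero_rpow hr0, mul_zero] at h
    calc _ ≤ ∫⁻ _, 1 ∂μ := lintegral_mono fun x => h
      _ = 1 := by simp
  | succ n ih =>
    rw [Function.iterate_succ_apply']
    refine (lintegral_expPowLog_powStep_le hK hβ₀ hβ₁ hU hk hr
      (measurable_iterate_powStep (by fun_prop) measurable_one n)).trans ?_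
    set B := expMoment (μ ⊗ₘ K) fun z => k * (|U z| / (1 - β)) ^ r
    calc _ ≤ ENNReal.ofReal β * (1 + B) + ENNReal.ofReal (1 - β) * (1 + B) := by
          gcongr; exact le_add_self
      _ = 1 + B := by
          rw [← add_mul, ← ENNReal.ofReal_add hβ₀.le (by linarith)]; simp

/-- Existence of a fixed point with thin tails. -/
theorem exists_fixedPt (hK : Kernel.Invariant K μ) {β : ℝ} (hβ₀ : 0 < β) (hβ₁ : β < 1) {r : ℝ}
    (hr : 1 < r) {U : X × X → ℝ} (hU : MemOrliczHeart r U (μ ⊗ₘ K)) :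
    ∃ v : X → ℝ, MemOrliczHeart r v μ ∧ logExpOp β U K v =ᵐ[μ] v := by
  obtain ⟨hUm, hUk⟩ := (memOrliczHeart_iff hr.le).1 hU
  have hUa : Measurable fun z => |U z| := by fun_prop
  have h1β : 0 < 1 - β := by linarith
  set S := powStep β (fun z => |U z|) K with hS
  have hsub1 : (1 : X → ℝ≥0∞) ≤ S 1 := by
    intro x
    have : (1 : ℝ≥0∞) = ∫⁻ _, 1 ∂(K x) := by simp
    simp only [Pi.one_apply, hS, powStep, ENNReal.one_rpow, one_mul]
    conv_lhs => rw [this]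
    refine lintegral_mono fun y => ?_
    rw [ENNReal.one_le_ofReal]
    exact Real.one_le_exp (abs_nonneg _)
  -- The minimal solution above `1` for `|U|`. The moment bounds uniform in `n` pass to it and make
  -- it finite almost everywhere.
  set H : X → ℝ≥0∞ := ⨆ n, S^[n] 1 with hHdef
  have hmonoH := (powStep_mono (K := K) hβ₀.le (fun z => |U z|)).monotone_iterate_of_le_map hsub1
  have hmeasn : ∀ n, Measurable (S^[n] 1) := measurable_iterate_powStep hUa measurable_one
  have hHm : Measurable H := by
    have e : H = fun x => ⨆ n, S^[n] 1 x := funext fun x => iSup_apply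
    rw [e]; exact Measurable.iSup hmeasn
  have hHfix : S H = H := powStep_iSup_iterate hβ₀ hUa measurable_one hsub1
  have hH1 : ∀ x, 1 ≤ H x := fun x => by
    have : (S^[0] 1) ≤ H := le_iSup (fun n => S^[n] 1) 0
    exact this x
  have hΦH : ∀ k : ℝ, 1 ≤ k → ∫⁻ x, expPowLog k r (H x) ∂μ < ∞ := by
    intro k hk
    have hΦ := measurable_expPowLog k r
    calc ∫⁻ x, expPowLog k r (H x) ∂μ ≤ ∫⁻ x, ⨆ n, expPowLog k r (S^[n] 1 x) ∂μ :=
          lintegral_mono fun x => by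
            rw [hHdef, iSup_apply]; exact expPowLog_iSup_le hk hr _
      _ = ⨆ n, ∫⁻ x, expPowLog k r (S^[n] 1 x) ∂μ :=
          lintegral_iSup (fun n => hΦ.comp (hmeasn n))
            fun n m h x => expPowLog_mono hk hr (hmonoH h x)
      _ ≤ 1 + expMoment (μ ⊗ₘ K) fun z => k * (|U z| / (1 - β)) ^ r :=
          iSup_le fun n => lintegral_expPowLog_iterate_le hK hβ₀ hβ₁ hUm hk hr n
      _ < ∞ := by
          refine ENNReal.add_lt_top.2 ⟨ENNReal.one_lt_top, ?_⟩
          convert hUk (k * (1 - β)⁻¹ ^ r) (by positivity) using 3 with z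
          rw [div_eq_mul_inv, Real.mul_rpow (abs_nonneg _) (by positivity)]; ring
  have hHfin : ∀ᵐ x ∂μ, H x < ∞ := by
    filter_upwards [ae_lt_top ((measurable_expPowLog 1 r).comp hHm) (hΦH 1 le_rfl).ne] with x hx
    refine lt_top_iff_ne_top.2 fun h => ?_
    rw [Function.comp_apply, h, expPowLog_top le_rfl hr] at hx
    exact lt_irrefl _ hx
  -- The iteration for `U` itself, started at `1 / H`. It stays below `H` because `U ≤ |U|`, so its
  -- limit `F` is trapped between `1 / H` and `H`.
  set T := powStep β U K with hT
  set F₀ : X → ℝ≥0∞ := fun x => (H x)⁻¹ with hF₀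
  have hF₀m : Measurable F₀ := hHm.inv
  have hsubF : F₀ ≤ T F₀ := fun x => by
    have := inv_powStep_le (K := K) hβ₀ hUm hHm hH1 x
    rwa [← hS, hHfix] at this
  set F : X → ℝ≥0∞ := ⨆ n, T^[n] F₀ with hFdef
  have hFm : Measurable F := by
    have e : F = fun x => ⨆ n, T^[n] F₀ x := funext fun x => iSup_apply
    rw [e]; exact Measurable.iSup (measurable_iterate_powStep hUm hF₀m)
  have hFfix : T F = F := powStep_iSup_iterate hβ₀ hUm hF₀m hsubF
  have hF₀F : F₀ ≤ F := le_iSup (fun n => T^[n] F₀) 0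
  have hTS : ∀ G, T G ≤ S G := fun G x => by
    refine lintegral_mono fun y => ?_
    gcongr
    exact le_abs_self _
  have hFH : F ≤ H := by
    refine iSup_le fun n => ?_
    induction n with
    | zero => exact fun x => (ENNReal.inv_le_one.2 (hH1 x)).trans (hH1 x)
    | succ n ih =>
      rw [Function.iterate_succ_apply']
      calc T (T^[n] F₀) ≤ T H := powStep_mono hβ₀.le _ ih
        _ ≤ S H := hTS H
        _ = H := hHfix
  have hFpos : ∀ x, H x < ∞ → 0 < F x := fun x hx =>
    (ENNReal.inv_pos.2 hx.ne).trans_le (hF₀F x)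
  have hFtop : ∀ x, H x < ∞ → F x < ∞ := fun x hx => (hFH x).trans_lt hx
  have hFreal : ∀ x, H x < ∞ → 0 < (F x).toReal := fun x hx =>
    ENNReal.toReal_pos (hFpos x hx).ne' (hFtop x hx).ne
  refine ⟨fun x => β * Real.log (F x).toReal, (memOrliczHeart_iff hr.le).2 ⟨by fun_prop, ?_⟩, ?_⟩
  · intro k hk
    -- The estimates for `expPowLog` require a coefficient of at least one.
    set k' := max k 1 with hk'
    have hk1 : 1 ≤ k' := le_max_right _ _
    have hlt : ENNReal.ofReal (Real.exp k') + ∫⁻ x, expPowLog k' r (H x) ∂μ < ∞ :=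
      ENNReal.add_lt_top.2 ⟨ENNReal.ofReal_lt_top, hΦH k' hk1⟩
    refine lt_of_le_of_lt ?_ hlt
    have e : ENNReal.ofReal (Real.exp k') = ∫⁻ _, ENNReal.ofReal (Real.exp k') ∂μ := by simp
    rw [e, ← lintegral_add_left measurable_const]
    refine lintegral_mono_ae ?_
    filter_upwards [hHfin] with x hx
    set t := Real.log (H x).toReal with ht
    have hH1' : 1 ≤ (H x).toReal := by
      rw [← ENNReal.toReal_one]; exact ENNReal.toReal_mono hx.ne (hH1 x)
    have ht0 : 0 ≤ t := Real.log_nonneg hH1'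
    have hHt : H x = ENNReal.ofReal (Real.exp t) := by
      rw [ht, Real.exp_log (by linarith), ENNReal.ofReal_toReal hx.ne]
    have hv : |β * Real.log (F x).toReal| ≤ t := by
      have hup : Real.log (F x).toReal ≤ t :=
        Real.log_le_log (hFreal x hx) (ENNReal.toReal_mono hx.ne (hFH x))
      have hlo : -t ≤ Real.log (F x).toReal := by
        rw [ht, ← Real.log_inv, ← ENNReal.toReal_inv]
        exact Real.log_le_log (by rw [ENNReal.toReal_inv]; positivity)
          (ENNReal.toReal_mono (hFtop x hx).ne (hF₀F x))
      rw [abs_mul, abs_of_pos hβ₀]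
      have := abs_le.2 ⟨hlo, hup⟩
      nlinarith [abs_nonneg (Real.log (F x).toReal)]
    rw [hHt]
    refine le_trans (ENNReal.ofReal_le_ofReal (Real.exp_le_exp.2 ?_))
      (exp_le_add_expPowLog hk1 hr ht0)
    have := Real.rpow_le_rpow (abs_nonneg _) hv (by linarith : 0 ≤ r)
    exact mul_le_mul (le_max_left _ _) this (by positivity) (by linarith)
  -- `H` is finite only `μ`-almost everywhere; stationarity carries this to `K x`-almost every `y`,
  -- where `F` is positive and finite and `exp(β log F) = F ^ β`.
  · have hae : ∀ᵐ x ∂μ, ∀ᵐ y ∂(K x), H y < ∞ :=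
      Measure.ae_ae_of_ae_bind K.measurable.aemeasurable (by rw [hK.def]; exact hHfin)
    filter_upwards [hae] with x hx
    have : expMoment (K x) (fun y => β * Real.log (F y).toReal + U (x, y)) = F x := by
      conv_rhs => rw [← hFfix]
      refine lintegral_congr_ae ?_
      filter_upwards [hx] with y hy
      rw [Real.exp_add, ENNReal.ofReal_mul (Real.exp_nonneg _), mul_comm β, Real.exp_mul,
        Real.exp_log (hFreal y hy), ← ENNReal.ofReal_rpow_of_pos (hFreal y hy),
        ENNReal.ofReal_toReal (hFtop y hy).ne]
    rw [logExpOp, this]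

end Existence

end

end RobustCV

namespace RobustCV

noncomputable section

variable {X : Type*} [MeasurableSpace X]

/-! ### Change of measure in Orlicz hearts -/

section ChangeOfMeasure

variable {S : Type*} [MeasurableSpace S] {μ ν : Measure S} [IsProbabilityMeasure μ]
  [IsProbabilityMeasure ν]

lemma mul_le_rpow_add_rpow (a b : ℝ≥0∞) {p q : ℝ} (hpq : p.HolderConjugate q) :
    a * b ≤ a ^ p + b ^ q := by
  refine (ENNReal.young_inequality a b hpq).trans (add_le_add ?_ ?_)
  · exact ENNReal.div_le_of_le_mul' (le_mul_of_one_le_left' (ENNReal.one_le_ofReal.2 hpq.lt.le))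
  · exact ENNReal.div_le_of_le_mul'
      (le_mul_of_one_le_left' (ENNReal.one_le_ofReal.2 hpq.symm.lt.le))

lemma ofReal_exp_rpow (a q : ℝ) :
    ENNReal.ofReal (Real.exp a) ^ q = ENNReal.ofReal (Real.exp (q * a)) := by
  rw [ENNReal.ofReal_rpow_of_pos (Real.exp_pos _), ← Real.exp_mul, mul_comm]

/-- Young splits density times exponential into `Δ ^ p` and an exponential with `k` replaced by
`qk`. The heart contains every multiple, so the factor `q` is free. -/
lemma MemOrliczHeart.of_lintegral_rnDeriv_rpow {r : ℝ} (hr : 1 ≤ r) {f : S → ℝ}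
    (hf : MemOrliczHeart r f μ) (hνμ : ν ≪ μ) {p : ℝ} (hp : 1 < p)
    (h : ∫⁻ x, ν.rnDeriv μ x ^ p ∂μ < ∞) : MemOrliczHeart r f ν := by
  obtain ⟨hfm, hk⟩ := (memOrliczHeart_iff hr).1 hf
  refine (memOrliczHeart_iff hr).2 ⟨hfm, fun k hk0 => ?_⟩
  have hpq : p.HolderConjugate (p / (p - 1)) := Real.HolderConjugate.conjExponent hp
  have hΔ := Measure.measurable_rnDeriv ν μ
  have hfin := hk ((p / (p - 1)) * k) (mul_pos hpq.symm.pos hk0)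
  refine lt_of_le_of_lt ?_ (ENNReal.add_lt_top.2 ⟨h, hfin⟩)
  unfold expMoment
  rw [← lintegral_rnDeriv_mul hνμ (by fun_prop), ← lintegral_add_left (by fun_prop)]
  refine lintegral_mono fun x => ?_
  refine (mul_le_rpow_add_rpow _ _ hpq).trans (le_of_eq ?_)
  rw [ofReal_exp_rpow]
  simp only [mul_assoc]

lemma MemOrliczHeart.of_lintegral_rnDeriv_rpow_neg {r : ℝ} (hr : 1 ≤ r) {f : S → ℝ}
    (hf : MemOrliczHeart r f ν) (hνμ : ν ≪ μ) (hμν : μ ≪ ν) {p : ℝ} (hp : 1 < p)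
    (h : ∫⁻ x, ν.rnDeriv μ x ^ (1 - p) ∂μ < ∞) : MemOrliczHeart r f μ := by
  obtain ⟨hfm, hk⟩ := (memOrliczHeart_iff hr).1 hf
  refine (memOrliczHeart_iff hr).2 ⟨hfm, fun k hk0 => ?_⟩
  have hpq : p.HolderConjugate (p / (p - 1)) := Real.HolderConjugate.conjExponent hp
  set q := p / (p - 1) with hq
  have hq0 : 0 < q := hpq.symm.pos
  have hp1 : 0 < p - 1 := by linarith
  have hΔ := Measure.measurable_rnDeriv ν μ
  have hfin := hk (q * k) (mul_pos hq0 hk0)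
  refine lt_of_le_of_lt ?_ (ENNReal.add_lt_top.2 ⟨h, hfin⟩)
  unfold expMoment
  rw [← lintegral_rnDeriv_mul hνμ (by fun_prop), ← lintegral_add_left (by fun_prop)]
  refine lintegral_mono_ae ?_
  filter_upwards [Measure.rnDeriv_pos' hμν, Measure.rnDeriv_lt_top ν μ] with x h0 ht
  set Δ := ν.rnDeriv μ x with hΔdef
  -- Inserting `Δ ^ (-1/q) Δ ^ (1/q)` before Young: the first factor yields `Δ ^ (-p/q) = Δ ^ (1 -
  -- p)`, and the second yields the density of `ν` times an exponential.
  calc ENNReal.ofReal (Real.exp (k * |f x| ^ r))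
      = Δ ^ (-q⁻¹) * (Δ ^ q⁻¹ * ENNReal.ofReal (Real.exp (k * |f x| ^ r))) := by
        rw [← mul_assoc, ← ENNReal.rpow_add _ _ h0.ne' ht.ne, neg_add_cancel, ENNReal.rpow_zero,
          one_mul]
    _ ≤ _ := mul_le_rpow_add_rpow _ _ hpq
    _ = _ := by
        rw [ENNReal.mul_rpow_of_nonneg _ _ hq0.le, ← ENNReal.rpow_mul, ← ENNReal.rpow_mul,
          inv_mul_cancel₀ hq0.ne', ENNReal.rpow_one, ofReal_exp_rpow, mul_assoc q]
        congr 2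
        rw [hq]; field_simp; ring

end ChangeOfMeasure

/-! ### Existence and uniqueness for the recursion -/

lemma MemOrliczHeart.const_mul {S : Type*} [MeasurableSpace S] {μ : Measure S}
    [IsProbabilityMeasure μ] {r : ℝ} (hr : 1 ≤ r) {f : S → ℝ} (hf : MemOrliczHeart r f μ) (c : ℝ) :
    MemOrliczHeart r (fun x => c * f x) μ := by
  obtain ⟨hfm, hk⟩ := (memOrliczHeart_iff hr).1 hf
  refine (memOrliczHeart_iff hr).2 ⟨hfm.const_mul c, fun k hk0 => ?_⟩
  refine lt_of_le_of_lt (expMoment_mono fun x => ?_) (hk (k * (|c| + 1) ^ r) (by positivity))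
  rw [mul_assoc, ← Real.mul_rpow (by positivity) (abs_nonneg _), abs_mul]
  gcongr
  linarith

lemma MemOrliczHeart.add {S : Type*} [MeasurableSpace S] {μ : Measure S}
    [IsProbabilityMeasure μ] {r : ℝ} (hr : 1 ≤ r) {f g : S → ℝ} (hf : MemOrliczHeart r f μ)
    (hg : MemOrliczHeart r g μ) : MemOrliczHeart r (fun x => f x + g x) μ := by
  obtain ⟨hfm, hfk⟩ := (memOrliczHeart_iff hr).1 hf
  obtain ⟨hgm, hgk⟩ := (memOrliczHeart_iff hr).1 hg
  have hr0 : 0 ≤ r := by linarith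
  refine (memOrliczHeart_iff hr).2 ⟨hfm.add hgm, fun k hk0 => ?_⟩
  have hk' : 0 < k * 2 ^ r := by positivity
  refine lt_of_le_of_lt ?_ (ENNReal.add_lt_top.2 ⟨hfk _ hk', hgk _ hk'⟩)
  unfold expMoment
  rw [← lintegral_add_left (by fun_prop)]
  refine lintegral_mono fun x => ?_
  have key : ∀ a b : ℝ, |a| ≤ |b| → k * |a + b| ^ r ≤ k * 2 ^ r * |b| ^ r := fun a b hab => by
    rw [mul_assoc, ← Real.mul_rpow (by norm_num) (abs_nonneg _)]
    gcongr
    linarith [abs_add_le a b]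
  rcases le_total |f x| |g x| with h | h
  · exact (ENNReal.ofReal_le_ofReal (Real.exp_le_exp.2 (key _ _ h))).trans le_add_self
  · beta_reduce
    rw [add_comm (f x)]
    exact (ENNReal.ofReal_le_ofReal (Real.exp_le_exp.2 (key _ _ h))).trans le_self_add

lemma cvOp_eq_logExpOp {β θ : ℝ} {u : X × X → ℝ} (hu : Measurable u) (K : Kernel X X)
    {f : X → ℝ} (hf : Measurable f) :
    cvOp β θ u K f = logExpOp β (fun z => riskCoef β θ * u z) K f := by
  ext x
  rw [cvOp, logExpOp, integral_exp_eq_expMoment (f := fun y => f y + riskCoef β θ * u (x, y))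
    (by fun_prop)]

theorem exists_uniqueFixedPt {K : Kernel X X} [IsMarkovKernel K] {μ : Measure X}
    [IsProbabilityMeasure μ] (hK : Kernel.Invariant K μ) {β : ℝ} (hβ₀ : 0 < β) (hβ₁ : β < 1)
    {r : ℝ} (hr : 1 < r) {U : X × X → ℝ} (hU : MemOrliczHeart r U (μ ⊗ₘ K)) :
    ∃ v : X → ℝ, MemOrliczHeart r v μ ∧ logExpOp β U K v =ᵐ[μ] v ∧
      ∀ s : ℝ, 1 < s → ∀ g : X → ℝ, MemOrliczHeart s g μ → logExpOp β U K g =ᵐ[μ] g →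
        g =ᵐ[μ] v := by
  obtain ⟨v, hv, hfix⟩ := exists_fixedPt hK hβ₀ hβ₁ hr hU
  exact ⟨v, hv, hfix, fun s hs g hg hgfix => fixedPt_ae_eq hK hβ₀ hβ₁ (hU.hasExpMoments hr.le)
    (hg.hasExpMoments hs.le) (hv.hasExpMoments hr.le) hgfix hfix⟩

theorem exists_isUniqueFixedPt {K : Kernel X X} [IsMarkovKernel K] {μ : Measure X}
    [IsProbabilityMeasure μ] (hK : Kernel.Invariant K μ) {β θ : ℝ} (hβ₀ : 0 < β) (hβ₁ : β < 1)
    {r : ℝ} (hr : 1 < r) {u : X × X → ℝ} (hu : MemOrliczHeart r u (μ ⊗ₘ K)) :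
    ∃ v : X → ℝ, IsUniqueFixedPt r β θ u μ K v := by
  have hum : Measurable u := hu.1.1
  obtain ⟨v, hv, hfix, huniq⟩ := exists_uniqueFixedPt hK hβ₀ hβ₁ hr
    (hu.const_mul hr.le (riskCoef β θ))
  refine ⟨v, ⟨hv, ?_⟩, fun s hs _ g hg => huniq s hs g hg.1 ?_⟩
  · rwa [cvOp_eq_logExpOp hum K hv.1.1]
  · rw [← cvOp_eq_logExpOp hum K hg.1.1.1]; exact hg.2

/-! ### Kernels with a log likelihood ratio -/

section LogRatio

variable [MeasurableSpace.CountablyGenerated X] {Q Qhat : Kernel X X} [IsMarkovKernel Q]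
  [IsMarkovKernel Qhat]

omit [IsMarkovKernel Q] [IsMarkovKernel Qhat] in
lemma measurable_logRatio : Measurable (logRatio Q Qhat) :=
  (Kernel.measurable_rnDeriv Qhat Q).ennreal_toReal.log

/-- The change of kernel becomes a change of exponent. Mutual absolute continuity makes the density
positive and finite `Q x`-almost everywhere, so `exp ∘ log` recovers it. -/
lemma expMoment_eq_expMoment_add_logRatio (h : EverywhereMAC Q Qhat) {x : X} {g : X → ℝ}
    (hg : Measurable g) :
    expMoment (Qhat x) g = expMoment (Q x) fun y => g y + logRatio Q Qhat (x, y) := by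
  unfold expMoment
  rw [← lintegral_rnDeriv_mul (h x).2 (by fun_prop)]
  refine lintegral_congr_ae ?_
  filter_upwards [Kernel.rnDeriv_eq_rnDeriv_measure (κ := Qhat) (η := Q) (a := x),
    (h x).1.ae_le (Kernel.rnDeriv_pos (κ := Qhat) (η := Q) (h x).2),
    Kernel.rnDeriv_lt_top Qhat Q (a := x)] with y hy h0 ht
  rw [← hy, Real.exp_add, ENNReal.ofReal_mul (Real.exp_nonneg _), logRatio,
    Real.exp_log (ENNReal.toReal_pos h0.ne' ht.ne), ENNReal.ofReal_toReal ht.ne, mul_comm]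

lemma expMoment_logRatio (h : EverywhereMAC Q Qhat) (x : X) :
    expMoment (Q x) (fun y => logRatio Q Qhat (x, y)) = 1 := by
  have h1 := expMoment_eq_expMoment_add_logRatio h (x := x) (g := fun _ => 0) measurable_const
  simp only [zero_add] at h1
  rw [← h1]; simp [expMoment]

lemma cvOp_eq_logExpOp_add_logRatio (h : EverywhereMAC Q Qhat) {β θ : ℝ} {u : X × X → ℝ}
    (hu : Measurable u) {f : X → ℝ} (hf : Measurable f) :
    cvOp β θ u Qhat f =
      logExpOp β (fun z => riskCoef β θ * u z + logRatio Q Qhat z) Q f := by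
  rw [cvOp_eq_logExpOp hu Qhat hf]
  ext x
  rw [logExpOp, logExpOp, expMoment_eq_expMoment_add_logRatio h (by fun_prop)]
  simp only [add_assoc]

omit [IsMarkovKernel Qhat] in
lemma measurable_score : Measurable (score Q Qhat) := by
  have h := (measurable_logRatio (Q := Q) (Qhat := Qhat)).stronglyMeasurable
  have h2 : StronglyMeasurable fun x => ∫ y, logRatio Q Qhat (x, y) ∂(Q x) :=
    StronglyMeasurable.integral_kernel_prod_right (f := fun x y => logRatio Q Qhat (x, y)) h
  exact measurable_logRatio.sub (h2.measurable.comp measurable_fst)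

/-- In case (a) the exponent `αu + ℓ̂` lies in the heart and existence applies under `Q` and `Q₀`.
In case (b) it is applied under `Qhat` and its own stationary law, and the density moments transport
the hearts both ways. -/
lemma exists_isUniqueFixedPt_of_AM2 {Q₀ : Measure X} [IsProbabilityMeasure Q₀]
    (hQ₀ : Kernel.Invariant Q Q₀) {β θ : ℝ} (hβ₀ : 0 < β) (hβ₁ : β < 1)
    {u : X × X → ℝ} {r M : ℝ} (hr : 1 < r) (hu : MemOrliczHeart r u (Q₀ ⊗ₘ Q))
    (h : AM2 r β θ M u Q₀ Q Qhat) : ∃ w : X → ℝ, IsUniqueFixedPt r β θ u Q₀ Qhat w := by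
  have hum : Measurable u := hu.1.1
  obtain ⟨hmac, ⟨hl, -, -⟩ | ⟨-, Qhat₀, hprob, hinv, hac1, hac2, p, hp, hp1, hp2, hp3⟩⟩ := h
  · obtain ⟨v, hv, hfix, huniq⟩ := exists_uniqueFixedPt hQ₀ hβ₀ hβ₁ hr
      ((hu.const_mul hr.le (riskCoef β θ)).add hr.le hl)
    refine ⟨v, ⟨hv, ?_⟩, fun s hs _ g hg => huniq s hs g hg.1 ?_⟩
    · rwa [cvOp_eq_logExpOp_add_logRatio hmac hum hv.1.1]
    · rw [← cvOp_eq_logExpOp_add_logRatio hmac hum hg.1.1.1]; exact hg.2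
  · have hac3 : Qhat₀ ⊗ₘ Qhat ≪ Q₀ ⊗ₘ Q :=
      hac2.compProd (Eventually.of_forall fun x => (hmac x).2)
    have hu' : MemOrliczHeart r u (Qhat₀ ⊗ₘ Qhat) :=
      hu.of_lintegral_rnDeriv_rpow hr.le hac3 hp (hp3.trans_lt ENNReal.ofReal_lt_top)
    obtain ⟨v, hv, huniq⟩ := exists_isUniqueFixedPt (θ := θ) hinv hβ₀ hβ₁ hr hu'
    refine ⟨v, ⟨hv.1.of_lintegral_rnDeriv_rpow_neg hr.le hac2 hac1 hp
      (hp2.trans_lt ENNReal.ofReal_lt_top), hac1.ae_le hv.2⟩, fun s hs hsr g hg => ?_⟩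
    exact hac1.ae_le (huniq s hs hsr g ⟨hg.1.of_lintegral_rnDeriv_rpow hs.le hac2 hp
      (hp1.trans_lt ENNReal.ofReal_lt_top), hac2.ae_le hg.2⟩)

/-- Exponential moments of the score control those of the log likelihood ratio. -/
lemma expMoment_logRatio_le {Q₀ : Measure X} [IsProbabilityMeasure Q₀]
    (hmac : EverywhereMAC Q Qhat) {k : ℝ} (hk : 1 ≤ k)
    (hη : expMoment (Q₀ ⊗ₘ Q) (fun z => k * |score Q Qhat z|) ≤ 2) :
    expMoment (Q₀ ⊗ₘ Q) (fun z => k / 2 * |logRatio Q Qhat z|) ≤ 6 := by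
  have hk0 : 0 < k := by linarith
  have hl := measurable_logRatio (Q := Q) (Qhat := Qhat)
  have hsc := measurable_score (Q := Q) (Qhat := Qhat)
  set c : X → ℝ := fun x => ∫ y, logRatio Q Qhat (x, y) ∂(Q x) with hc
  have hscore : ∀ z, score Q Qhat z = logRatio Q Qhat z - c z.1 := fun z => rfl
  have hcm : Measurable c :=
    (StronglyMeasurable.integral_kernel_prod_right
      (f := fun x y => logRatio Q Qhat (x, y)) hl.stronglyMeasurable).measurable
  -- Jensen from `E exp(ℓ̂) = 1`. For the negative sign below, Hölder interpolates the constant `1`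
  -- between `exp(ℓ̂)` and `exp(-k ℓ̂)`.
  have hpos : ∀ x, 1 ≤ expMoment (Q x) (fun y => k * logRatio Q Qhat (x, y)) := fun x => by
    have h := rpow_lintegral_le (ν := Q x)
      (Z := fun y => ENNReal.ofReal (Real.exp (logRatio Q Qhat (x, y)))) (by fun_prop) hk
    have e := expMoment_logRatio hmac x
    unfold expMoment at e
    rw [e, ENNReal.one_rpow] at h
    simpa only [expMoment, ofReal_exp_rpow] using h
  have hneg : ∀ x, 1 ≤ expMoment (Q x) (fun y => -k * logRatio Q Qhat (x, y)) := fun x => by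
    have h := expMoment_convex (μ := Q x) (f := fun y => logRatio Q Qhat (x, y))
      (g := fun y => -k * logRatio Q Qhat (x, y)) (by fun_prop) (by fun_prop)
      (p := k / (1 + k)) (q := 1 / (1 + k)) (by positivity) (by positivity) (by field_simp; ring)
    have e : (fun y => k / (1 + k) * logRatio Q Qhat (x, y) +
        1 / (1 + k) * (-k * logRatio Q Qhat (x, y))) = fun _ => 0 := by
      ext y; field_simp; ring
    rw [e, expMoment_logRatio hmac, ENNReal.one_rpow, one_mul] at h
    simp only [expMoment, Real.exp_zero, ENNReal.ofReal_one, lintegral_one, measure_univ] at h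
    by_contra hlt
    push Not at hlt
    exact absurd h (not_le.2 (ENNReal.rpow_lt_one hlt (by positivity)))
  -- Conditionally on `x`, `E exp(jη̂) = exp(-jc) E exp(jℓ̂) ≥ exp(-jc)`. So the score controls the
  -- conditional mean `c` that was subtracted from `ℓ̂`.
  have hcbound : ∀ j : ℝ, |j| = k →
      (∀ x, 1 ≤ expMoment (Q x) (fun y => j * logRatio Q Qhat (x, y))) →
      expMoment Q₀ (fun x => -j * c x) ≤ 2 := fun j hj hjpos => by
    refine le_trans ?_ (le_trans (expMoment_mono (f := fun z => j * score Q Qhat z) fun z => ?_) hη)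
    · rw [expMoment_compProd (by fun_prop)]
      refine lintegral_mono fun x => ?_
      calc ENNReal.ofReal (Real.exp (-j * c x))
          ≤ ENNReal.ofReal (Real.exp (-j * c x)) *
              expMoment (Q x) (fun y => j * logRatio Q Qhat (x, y)) :=
            le_mul_of_one_le_right' (hjpos x)
        _ = _ := by
            unfold expMoment
            rw [← lintegral_const_mul' _ _ ENNReal.ofReal_ne_top]
            refine lintegral_congr fun y => ?_
            rw [← ENNReal.ofReal_mul (Real.exp_nonneg _), ← Real.exp_add]
            simp only [hscore]
            congr 2; ring
    · rw [← hj, ← abs_mul]; exact le_abs_self _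
  have hcabs : expMoment Q₀ (fun x => k * |c x|) ≤ 4 := by
    have h := expMoment_abs_le (μ := Q₀) (f := fun x => k * c x) (by fun_prop)
    simp only [abs_mul, abs_of_pos hk0] at h
    have h1 := hcbound (-k) (by rw [abs_neg, abs_of_pos hk0]) hneg
    have h2 := hcbound k (abs_of_pos hk0) hpos
    simp only [neg_neg, neg_mul] at h1 h2
    calc _ ≤ _ := h
      _ ≤ 2 + 2 := add_le_add h1 h2
      _ = 4 := by norm_num
  calc _ ≤ expMoment (Q₀ ⊗ₘ Q) (fun z => (k * |score Q Qhat z| + k * |c z.1|) / 2) := by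
        refine expMoment_mono fun z => ?_
        have : |logRatio Q Qhat z| ≤ |score Q Qhat z| + |c z.1| := by
          have e : logRatio Q Qhat z = score Q Qhat z + c z.1 := by rw [hscore]; ring
          rw [e]; exact abs_add_le _ _
        nlinarith
    _ ≤ _ := expMoment_half_add_le (by fun_prop)
    _ ≤ 2 + 4 := by
        refine add_le_add hη ?_
        rw [expMoment_comp_fst (f := fun x => k * |c x|) (by fun_prop)]; exact hcabs
    _ = 6 := by norm_num

end LogRatio

end

end RobustCV

namespace RobustCV

noncomputable section

variable {X : Type*} [MeasurableSpace X]

/-! ### Perturbation bound for the fixed point -/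

lemma ofReal_exp_add_three (x y z : ℝ) :
    ENNReal.ofReal (Real.exp (x + y + z)) ≤ ENNReal.ofReal (Real.exp (3 * x)) +
      ENNReal.ofReal (Real.exp (3 * y)) + ENNReal.ofReal (Real.exp (3 * z)) := by
  have key : ∀ w, x + y + z ≤ 3 * w →
      ENNReal.ofReal (Real.exp (x + y + z)) ≤ ENNReal.ofReal (Real.exp (3 * w)) := fun w hw =>
    ENNReal.ofReal_le_ofReal (Real.exp_le_exp.2 hw)
  rcases le_total x y with h1 | h1
  · rcases le_total y z with h2 | h2
    · exact (key z (by linarith)).trans le_add_self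
    · exact (key y (by linarith)).trans (le_add_self.trans le_self_add)
  · rcases le_total x z with h2 | h2
    · exact (key z (by linarith)).trans le_add_self
    · exact (key x (by linarith)).trans (le_self_add.trans le_self_add)

section Perturbation

variable {K : Kernel X X} [IsMarkovKernel K] {μ : Measure X} [IsProbabilityMeasure μ]

omit [IsMarkovKernel K] [IsProbabilityMeasure μ] in
lemma expMoment_two_mul_add_lt_top {β : ℝ} (hβ₀ : 0 < β) (hβ₁ : β < 1) {w l : X × X → ℝ}
    (hw : HasExpMoments (μ ⊗ₘ K) w)
    (hl6 : expMoment (μ ⊗ₘ K) (fun z => 6 / (1 - β) * |l z|) ≤ 6) :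
    expMoment (μ ⊗ₘ K) (fun z => 2 * (w z + l z)) < ∞ := by
  have hwm := hw.1
  have h1β : 0 < 1 - β := by linarith
  have h6 : 4 ≤ 6 / (1 - β) := by rw [le_div_iff₀ h1β]; nlinarith
  have hlt : expMoment (μ ⊗ₘ K) (fun z => 4 * w z) +
      expMoment (μ ⊗ₘ K) (fun z => 6 / (1 - β) * |l z|) < ∞ :=
    ENNReal.add_lt_top.2 ⟨hw.2 4, hl6.trans_lt (by simp)⟩
  refine lt_of_le_of_lt (le_trans (expMoment_mono fun z => ?_)
    (expMoment_half_add_le (by fun_prop))) hlt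
  have : 4 * |l z| ≤ 6 / (1 - β) * |l z| := by gcongr
  linarith [le_abs_self (l z)]

/-- The exponent is split into the parts of `w`, `l` and the residual. The condition `htb` is what
turns the residual part into at most `|d| / b`, so `t` may be of order `1 / b`. -/
lemma expMoment_extrapolation_le (hK : Kernel.Invariant K μ) {β : ℝ} (hβ₀ : 0 < β) (hβ₁ : β < 1)
    {w l : X × X → ℝ} (hw : HasExpMoments (μ ⊗ₘ K) w) (hl : Measurable l)
    (hl6 : expMoment (μ ⊗ₘ K) (fun z => 6 / (1 - β) * |l z|) ≤ 6)
    {f₀ f₁ d₀ d₁ d : X → ℝ} (hf₀ : HasExpMoments μ f₀) (hf₁ : HasExpMoments μ f₁)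
    (hd₀ : Measurable d₀) (hd₁ : Measurable d₁) (hd : Measurable d)
    (h₀ : ∀ᵐ x ∂μ, logExpOp β (fun z => w z + l z) K f₀ x = f₀ x + d₀ x)
    (h₁ : ∀ᵐ x ∂μ, logExpOp β (fun z => w z + l z) K f₁ x = f₁ x + d₁ x)
    {t b : ℝ} (ht : 1 ≤ t) (hb : 0 < b) (htb : 6 * t * b ≤ β * (1 - β))
    (hdb : expMoment μ (fun x => |d x| / b) ≤ 2)
    (hdd : ∀ x, |(1 + t) * d₀ x - t * d₁ x| ≤ 2 * t * |d x|) :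
    expMoment μ (fun x => ((1 + t) * f₀ x - t * f₁ x) / β) ≤
      expMoment (μ ⊗ₘ K) (fun z => 3 / (1 - β) * w z) + 6 + 2 := by
  have hwm := hw.1
  have h1β : 0 < 1 - β := by linarith
  refine (extrapolation_bound hK hβ₀ hβ₁ (hwm.add hl)
    (expMoment_two_mul_add_lt_top hβ₀ hβ₁ hw hl6) hf₀ hf₁ hd₀ hd₁ h₀ h₁
    (by linarith)).trans ?_
  have hdb' : expMoment (μ ⊗ₘ K) (fun z => |d z.1| / b) ≤ 2 := by
    rw [expMoment_comp_fst (f := fun x => |d x| / b) (by fun_prop)]; exact hdb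
  refine le_trans ?_ (add_le_add (add_le_add le_rfl hl6) hdb')
  unfold expMoment
  rw [← lintegral_add_left (by fun_prop), ← lintegral_add_left (by fun_prop)]
  refine lintegral_mono fun z => ?_
  set e := (1 + t) * d₀ z.1 - t * d₁ z.1 with he
  have e1 : ((w + l) z - e / β) / (1 - β) =
      w z / (1 - β) + l z / (1 - β) + -(e / β) / (1 - β) := by
    simp only [Pi.add_apply]; ring
  beta_reduce
  rw [e1]
  refine (ofReal_exp_add_three _ _ _).trans ?_
  gcongr ENNReal.ofReal (Real.exp ?_) + ENNReal.ofReal (Real.exp ?_) +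
    ENNReal.ofReal (Real.exp ?_)
  · exact le_of_eq (by ring)
  · calc 3 * (l z / (1 - β)) ≤ 3 * (2 * |l z| / (1 - β)) := by
          gcongr; linarith [le_abs_self (l z), abs_nonneg (l z)]
      _ = 6 / (1 - β) * |l z| := by ring
  · have h1 : -e ≤ 2 * t * |d z.1| := (neg_le_abs e).trans (hdd z.1)
    calc 3 * (-(e / β) / (1 - β)) = 3 * (-e) / (β * (1 - β)) := by field_simp
      _ ≤ 3 * (2 * t * |d z.1|) / (β * (1 - β)) := by gcongr
      _ ≤ |d z.1| / b := by
          rw [div_le_div_iff₀ (by positivity) hb]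
          nlinarith [abs_nonneg (d z.1)]

/-- If the operator is perturbed by an exponent `l` with small exponential moments, then the
distance between the fixed point `g` of the perturbed operator and `f` is controlled by the
residual of `f`. -/
lemma expMoment_fixedPt_sub_le (hK : Kernel.Invariant K μ) {β : ℝ} (hβ₀ : 0 < β) (hβ₁ : β < 1)
    {w l : X × X → ℝ} (hw : HasExpMoments (μ ⊗ₘ K) w) (hl : Measurable l)
    (hl6 : expMoment (μ ⊗ₘ K) (fun z => 6 / (1 - β) * |l z|) ≤ 6)
    {f g : X → ℝ} (hf : HasExpMoments μ f) (hg : HasExpMoments μ g)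
    (hgfix : logExpOp β (fun z => w z + l z) K g =ᵐ[μ] g)
    {t b : ℝ} (ht : 1 ≤ t) (hb : 0 < b) (htb : 6 * t * b ≤ β * (1 - β))
    (hdb : expMoment μ (fun x => |logExpOp β (fun z => w z + l z) K f x - f x| / b) ≤ 2) :
    expMoment μ (fun x => |g x - f x| / (2 * β / t)) ≤
      2 * (expMoment (μ ⊗ₘ K) (fun z => 3 / (1 - β) * w z) + 6 + 2 +
        expMoment μ (fun x => -β⁻¹ * f x)) := by
  have hwm := hw.1
  have hfm := hf.1
  have hgm := hg.1
  have ht0 : 0 < t := by linarith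
  set d : X → ℝ := fun x => logExpOp β (fun z => w z + l z) K f x - f x with hd
  have hdm : Measurable d := (measurable_logExpOp (hwm.add hl) hfm).sub hfm
  set B := expMoment (μ ⊗ₘ K) (fun z => 3 / (1 - β) * w z) + 6 + 2
  have hf' : ∀ᵐ x ∂μ, logExpOp β (fun z => w z + l z) K f x = f x + d x :=
    Eventually.of_forall fun x => by simp [hd]
  have hg' : ∀ᵐ x ∂μ, logExpOp β (fun z => w z + l z) K g x = g x + 0 := by
    filter_upwards [hgfix] with x hx; simpa using hx
  have up := expMoment_extrapolation_le hK hβ₀ hβ₁ hw hl hl6 hg hf (d₀ := fun _ => 0)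
    measurable_const hdm hdm hg' hf' ht hb htb hdb (fun x => by
      simp only [mul_zero, zero_sub, abs_neg, abs_mul, abs_of_pos ht0]
      nlinarith [abs_nonneg (d x)])
  have lo := expMoment_extrapolation_le hK hβ₀ hβ₁ hw hl hl6 hf hg (d₁ := fun _ => 0)
    hdm measurable_const hdm hf' hg' ht hb htb hdb (fun x => by
      simp only [mul_zero, sub_zero, abs_mul, abs_of_pos (show 0 < 1 + t by linarith)]
      nlinarith [abs_nonneg (d x)])
  -- Averaging with `-f / β` removes the leftover `f`: the extrapolations become `(1 + t)(g - f) /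
  -- (2β)` and `t (f - g) / (2β)`. One of them dominates `t |g - f| / (2β)` according to the sign of
  -- `g - f`.
  have key : ∀ F : X → ℝ, Measurable F → expMoment μ F ≤ B →
      expMoment μ (fun x => (F x + -β⁻¹ * f x) / 2) ≤ B + expMoment μ (fun x => -β⁻¹ * f x) :=
    fun F hF h => (expMoment_half_add_le hF).trans (add_le_add h le_rfl)
  have up' := key _ (by fun_prop) up
  have lo' := key _ (by fun_prop) lo
  rw [two_mul (B + _)]
  refine le_trans ?_ (add_le_add up' lo')
  unfold expMoment
  rw [← lintegral_add_left (by fun_prop)]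
  refine lintegral_mono fun x => ?_
  rcases le_total (f x) (g x) with h | h
  · refine le_trans (ENNReal.ofReal_le_ofReal (Real.exp_le_exp.2 ?_)) le_self_add
    beta_reduce
    rw [abs_of_nonneg (sub_nonneg.2 h)]
    have e1 : (g x - f x) / (2 * β / t) = t * (g x - f x) / (2 * β) := by field_simp
    have e2 : (((1 + t) * g x - t * f x) / β + -β⁻¹ * f x) / 2 =
        (1 + t) * (g x - f x) / (2 * β) := by field_simp; ring
    rw [e1, e2]
    have := sub_nonneg.2 h
    gcongr
    linarith
  · refine le_trans (ENNReal.ofReal_le_ofReal (Real.exp_le_exp.2 (le_of_eq ?_))) le_add_self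
    beta_reduce
    rw [abs_of_nonpos (sub_nonpos.2 h)]
    field_simp; ring

end Perturbation

/-! ### Distortions -/

lemma abs_exp_sub_one_le_mul_exp (z : ℝ) : |Real.exp z - 1| ≤ |z| * Real.exp |z| := by
  rcases le_total 0 z with h | h
  · rw [abs_of_nonneg h, abs_of_nonneg (by linarith [Real.one_le_exp h])]
    have h1 := Real.add_one_le_exp (-z)
    have h2 : Real.exp (-z) * Real.exp z = 1 := by rw [← Real.exp_add]; simp
    nlinarith [Real.exp_pos z]
  · rw [abs_of_nonpos h, abs_of_nonpos (by linarith [Real.exp_le_one_iff.2 h])]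
    have h1 := Real.add_one_le_exp z
    have h2 : 1 ≤ Real.exp (-z) := Real.one_le_exp (by linarith)
    nlinarith

/-- With `s = |z| / b`, use `s ≤ 4p exp(s / 4p)` and `bs ≤ s / 4p`. This extracts a factor `b`, and
the `p`-th power of what remains is only `exp(s / 2)`, leaving room to pair with `exp(p g)`. -/
lemma abs_exp_sub_one_le_of_small {b p : ℝ} (hb : 0 < b) (hp : 0 < p) (hbp : 4 * p * b ≤ 1)
    (z : ℝ) : |Real.exp z - 1| ≤ 4 * p * b * Real.exp (|z| / b / (2 * p)) := by
  refine (abs_exp_sub_one_le_mul_exp z).trans ?_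
  set s := |z| / b with hs
  have hs0 : 0 ≤ s := by positivity
  have hz : |z| = b * s := by rw [hs]; field_simp
  have h1 : s ≤ 4 * p * Real.exp (s / (4 * p)) := by
    have := Real.add_one_le_exp (s / (4 * p))
    calc s = 4 * p * (s / (4 * p)) := by field_simp
      _ ≤ 4 * p * Real.exp (s / (4 * p)) := by gcongr; linarith
  have h2 : b * s ≤ s / (4 * p) := by rw [le_div_iff₀ (by positivity)]; nlinarith
  have h3 : s / (2 * p) = s / (4 * p) + s / (4 * p) := by field_simp; ring
  rw [hz, h3, Real.exp_add]
  calc b * s * Real.exp (b * s)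
      ≤ b * (4 * p * Real.exp (s / (4 * p))) * Real.exp (s / (4 * p)) := by gcongr
    _ = _ := by ring

lemma eLpNorm_exp_mul_exp_sub_one_le {S : Type*} [MeasurableSpace S] {ν : Measure S}
    {g z : S → ℝ} (hg : Measurable g) {b p : ℝ} (hb : 0 < b) (hp : 0 < p)
    (hbp : 4 * p * b ≤ 1) (hz : expMoment ν (fun x => |z x| / b) ≤ 4) :
    eLpNorm (fun x => Real.exp (g x) * (Real.exp (z x) - 1)) (ENNReal.ofReal p) ν ≤
      ENNReal.ofReal (4 * p * b) * (expMoment ν (fun x => 2 * p * g x) + 4) ^ (1 / p) := by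
  have h4pb : 0 < 4 * p * b := by positivity
  rw [eLpNorm_eq_lintegral_rpow_enorm_toReal (by simpa using hp) ENNReal.ofReal_ne_top,
    ENNReal.toReal_ofReal hp.le]
  have h1 : ∫⁻ x, ‖Real.exp (g x) * (Real.exp (z x) - 1)‖ₑ ^ p ∂ν ≤
      ENNReal.ofReal (4 * p * b) ^ p * (expMoment ν (fun x => 2 * p * g x) + 4) := by
    calc _ ≤ ∫⁻ x, ENNReal.ofReal (4 * p * b) ^ p *
          ENNReal.ofReal (Real.exp ((2 * p * g x + |z x| / b) / 2)) ∂ν := by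
          refine lintegral_mono fun x => ?_
          have e : Real.exp ((2 * p * g x + |z x| / b) / 2) =
              Real.exp (g x + |z x| / b / (2 * p)) ^ p := by
            rw [← Real.exp_mul]; congr 1; field_simp
          rw [e, ← ENNReal.ofReal_rpow_of_pos (Real.exp_pos _),
            ← ENNReal.mul_rpow_of_nonneg _ _ hp.le, ← ENNReal.ofReal_mul h4pb.le]
          refine ENNReal.rpow_le_rpow ?_ hp.le
          rw [Real.enorm_eq_ofReal_abs, abs_mul, Real.abs_exp, Real.exp_add]
          refine ENNReal.ofReal_le_ofReal ?_
          calc _ ≤ Real.exp (g x) * (4 * p * b * Real.exp (|z x| / b / (2 * p))) := by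
                gcongr; exact abs_exp_sub_one_le_of_small hb hp hbp _
            _ = _ := by ring
      _ = ENNReal.ofReal (4 * p * b) ^ p *
            expMoment ν (fun x => (2 * p * g x + |z x| / b) / 2) :=
          lintegral_const_mul' _ _ (ENNReal.rpow_ne_top_of_nonneg hp.le ENNReal.ofReal_ne_top)
      _ ≤ _ := by
          gcongr
          exact (expMoment_half_add_le (by fun_prop)).trans (add_le_add le_rfl hz)
  calc _ ≤ (ENNReal.ofReal (4 * p * b) ^ p *
        (expMoment ν (fun x => 2 * p * g x) + 4)) ^ (1 / p) := by gcongr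
    _ = _ := by
        rw [ENNReal.mul_rpow_of_nonneg _ _ (by positivity), ← ENNReal.rpow_mul,
          mul_one_div_cancel hp.ne', ENNReal.rpow_one]

lemma ae_compProd_of_ae {K : Kernel X X} [IsMarkovKernel K] {μ : Measure X}
    [IsProbabilityMeasure μ] {p : X → Prop} (h : ∀ᵐ x ∂μ, p x) : ∀ᵐ z ∂(μ ⊗ₘ K), p z.1 := by
  rw [← Measure.fst_compProd μ K] at h
  exact ae_of_ae_map measurable_fst.aemeasurable h

/-- The distortion of a fixed point is a normalized exponential. -/
lemma distortion_ae_eq {K : Kernel X X} [IsMarkovKernel K] {μ : Measure X}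
    [IsProbabilityMeasure μ] (hK : Kernel.Invariant K μ) {β θ : ℝ} (hβ₀ : 0 < β)
    {u : X × X → ℝ} (hu : HasExpMoments (μ ⊗ₘ K) u) {v : X → ℝ} (hv : HasExpMoments μ v)
    (hfix : cvOp β θ u K v =ᵐ[μ] v) :
    ∀ᵐ z ∂(μ ⊗ₘ K), distortion β θ u K v z = distortionEst β θ u v z := by
  have hum := hu.1
  have hvm := hv.1
  have hU := hu.const_mul (riskCoef β θ)
  rw [cvOp_eq_logExpOp hum K hvm] at hfix
  have h := ae_expMoment_eq_of_logExpOp hK hβ₀ hU.1 (hU.2 2) hv (d := fun _ => 0)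
    (by filter_upwards [hfix] with x hx; simpa using hx)
  filter_upwards [ae_compProd_of_ae (K := K) h] with z hz
  rw [distortion, distortionEst,
    integral_exp_eq_expMoment (f := fun y => v y + riskCoef β θ * u (z.1, y)) (by fun_prop), hz,
    ENNReal.toReal_ofReal (Real.exp_nonneg _), add_zero, ← Real.exp_sub]
  congr 1; ring

lemma expMoment_increment_le {K : Kernel X X} [IsMarkovKernel K] {μ : Measure X}
    [IsProbabilityMeasure μ] (hK : Kernel.Invariant K μ) {β : ℝ} (hβ₀ : 0 < β) (hβ₁ : β < 1)
    {δ : X → ℝ} (hδ : Measurable δ) {c : ℝ} (hc : 0 < c)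
    (h : expMoment μ (fun x => |δ x| / c) ≤ 2) :
    expMoment (μ ⊗ₘ K) (fun z => |δ z.2 - β⁻¹ * δ z.1| / (2 * c / β)) ≤ 4 := by
  calc _ ≤ expMoment (μ ⊗ₘ K) (fun z => (|δ z.2| / c + |δ z.1| / c) / 2) := by
        refine expMoment_mono fun z => ?_
        have h1 : |δ z.2 - β⁻¹ * δ z.1| ≤ |δ z.2| + β⁻¹ * |δ z.1| := by
          refine (abs_sub _ _).trans (le_of_eq ?_)
          rw [abs_mul, abs_of_pos (inv_pos.2 hβ₀)]
        calc _ ≤ (|δ z.2| + β⁻¹ * |δ z.1|) / (2 * c / β) := by gcongr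
          _ = (β * |δ z.2| + |δ z.1|) / c / 2 := by field_simp
          _ ≤ (1 * |δ z.2| + |δ z.1|) / c / 2 := by gcongr
          _ = _ := by ring
    _ ≤ _ := expMoment_half_add_le (by fun_prop)
    _ ≤ 2 + 2 := by
        rw [expMoment_comp_snd hK (f := fun x => |δ x| / c) (by fun_prop),
          expMoment_comp_fst (f := fun x => |δ x| / c) (by fun_prop)]
        exact add_le_add h h
    _ = 4 := by norm_num

end

end RobustCV

namespace RobustCV

/-! ### Stochastic order symbols -/

section Stochastic

variable {Ω : Type*} [MeasurableSpace Ω] {P : Measure Ω}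

lemma WPA1.mono {A B : ℕ → Ω → Prop} (hA : WPA1 P A) (h : ∀ n ω, A n ω → B n ω) : WPA1 P B :=
  tendsto_of_tendsto_of_tendsto_of_le_of_le tendsto_const_nhds hA (fun _ => zero_le)
    fun n => measure_mono fun _ hω hA' => hω (h n _ hA')

lemma WPA1.and {A B : ℕ → Ω → Prop} (hA : WPA1 P A) (hB : WPA1 P B) :
    WPA1 P fun n ω => A n ω ∧ B n ω := by
  have h := Tendsto.add hA hB
  rw [add_zero] at h
  refine tendsto_of_tendsto_of_tendsto_of_le_of_le tendsto_const_nhds h (fun _ => zero_le)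
    fun n => le_trans (measure_mono fun ω hω => ?_) (measure_union_le _ _)
  exact not_and_or.1 hω

lemma IsLittleOP.wpa1 {Z : ℕ → Ω → ℝ≥0∞} (hZ : IsLittleOP P Z) {ε : ℝ} (hε : 0 < ε) :
    WPA1 P fun n ω => Z n ω ≤ ENNReal.ofReal ε := by
  simpa only [WPA1, not_le] using hZ ε hε

/-- Transfers a rate through a deterministic bound valid on likely events. The bound may start at an
`n` depending on `C`, as smallness conditions on `C * a n` require. -/
lemma IsBigOP.of_eventually_imp {Z Z' : ℕ → Ω → ℝ≥0∞} {a : ℕ → ℝ} {A : ℕ → Ω → Prop}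
    (hZ : IsBigOP P Z a) (hA : WPA1 P A)
    (h : ∀ C : ℝ, 0 < C → ∃ C' : ℝ, 0 < C' ∧ ∀ᶠ n in atTop, ∀ ω, A n ω →
      Z n ω ≤ ENNReal.ofReal (C * a n) → Z' n ω ≤ ENNReal.ofReal (C' * a n)) :
    IsBigOP P Z' a := by
  intro ε hε
  obtain ⟨C, hC, hCn⟩ := hZ (ε / 2) (by positivity)
  obtain ⟨C', hC', hn⟩ := h C hC
  refine ⟨C', hC', ?_⟩
  have hA' : ∀ᶠ n in atTop, P {ω | ¬ A n ω} ≤ ENNReal.ofReal (ε / 2) :=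
    hA.eventually_le_const (by simpa using hε)
  filter_upwards [hCn, hn, hA'] with n h1 h2 h3
  calc _ ≤ P ({ω | ¬ A n ω} ∪ {ω | ENNReal.ofReal (C * a n) < Z n ω}) := by
        refine measure_mono fun ω hω => ?_
        by_contra hcon
        simp only [Set.mem_union, Set.mem_ofPred_eq, not_or, not_not, not_lt] at hcon
        exact absurd (h2 ω hcon.1 hcon.2) (not_le.2 hω)
    _ ≤ _ := measure_union_le _ _
    _ ≤ ENNReal.ofReal (ε / 2) + ENNReal.ofReal (ε / 2) := add_le_add h3 h1
    _ = ENNReal.ofReal ε := by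
        rw [← ENNReal.ofReal_add (by positivity) (by positivity), add_halves]

end Stochastic

/-! ### Convergence rates -/

section Rates

variable {X : Type*} [MeasurableSpace X] {Q : Kernel X X} [IsMarkovKernel Q] {Q₀ : Measure X}
  [IsProbabilityMeasure Q₀]

/-- The error of the estimated fixed point is of the order of the residual of the true one. -/
lemma exists_luxNorm_sub_le [MeasurableSpace.CountablyGenerated X] (hQ₀ : Kernel.Invariant Q Q₀)
    {β θ : ℝ} (hβ₀ : 0 < β) (hβ₁ : β < 1) {u : X × X → ℝ} (hu : HasExpMoments (Q₀ ⊗ₘ Q) u)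
    {v : X → ℝ} (hv : HasExpMoments Q₀ v) :
    ∃ N : ℝ, 0 < N ∧ ∀ (Qhat : Kernel X X) [IsMarkovKernel Qhat] (w : X → ℝ) (c : ℝ),
      EverywhereMAC Q Qhat →
      luxNorm 1 (score Q Qhat) (Q₀ ⊗ₘ Q) ≤ ENNReal.ofReal ((1 - β) / 24) →
      HasExpMoments Q₀ w → cvOp β θ u Qhat w =ᵐ[Q₀] w →
      0 < c → 12 * c ≤ β * (1 - β) →
      luxNorm 1 (cvOp β θ u Qhat v - v) Q₀ ≤ ENNReal.ofReal c →
      luxNorm 1 (w - v) Q₀ ≤ ENNReal.ofReal (N * c) := by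
  have h1β : 0 < 1 - β := by linarith
  have hum := hu.1
  have hvm := hv.1
  have hU := hu.const_mul (riskCoef β θ)
  set B : ℝ≥0∞ := 2 * (expMoment (Q₀ ⊗ₘ Q) (fun z => 3 / (1 - β) * (riskCoef β θ * u z)) + 6 + 2 +
    expMoment Q₀ (fun x => -β⁻¹ * v x)) with hB
  have hBt : B < ∞ := by
    have h1 := hU.2 (3 / (1 - β))
    have h2 := hv.2 (-β⁻¹)
    refine ENNReal.mul_lt_top (by simp) (ENNReal.add_lt_top.2 ⟨ENNReal.add_lt_top.2
      ⟨ENNReal.add_lt_top.2 ⟨h1, by simp⟩, by simp⟩, h2⟩)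
  set m := max 1 B.toReal with hm
  have hm1 : 1 ≤ m := le_max_left _ _
  refine ⟨m * (24 / (1 - β)), by positivity, ?_⟩
  intro Qhat _ w c hmac hscore hw hwfix hc hc12 hd
  have hl := measurable_logRatio (Q := Q) (Qhat := Qhat)
  have hwm := hw.1
  rw [cvOp_eq_logExpOp_add_logRatio hmac hum hwm] at hwfix
  rw [cvOp_eq_logExpOp_add_logRatio hmac hum hvm] at hd
  -- Doubling `(1 - β) / 24` gives the strict inequality needed to bound the modular at that scale.
  -- Passing from score to `ℓ̂` halves `12 / (1 - β)` to `6 / (1 - β)`.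
  have hlog : expMoment (Q₀ ⊗ₘ Q) (fun z => 6 / (1 - β) * |logRatio Q Qhat z|) ≤ 6 := by
    have h12 : 1 ≤ 12 / (1 - β) := by rw [le_div_iff₀ h1β]; linarith
    have hsc := expMoment_abs_div_le_two (μ := Q₀ ⊗ₘ Q) (f := score Q Qhat)
      (c := (1 - β) / 12) (by positivity) (hscore.trans_lt
        ((ENNReal.ofReal_lt_ofReal_iff (by positivity)).2 (by linarith)))
    have h := expMoment_logRatio_le (Q₀ := Q₀) hmac h12 (by
      refine le_trans (le_of_eq ?_) hsc
      congr 1; ext z; field_simp)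
    refine le_trans (le_of_eq ?_) h
    congr 1; ext z; ring
  have hd2 := expMoment_abs_div_le_two (μ := Q₀) (c := 2 * c) (by positivity) (hd.trans_lt
    ((ENNReal.ofReal_lt_ofReal_iff (by positivity)).2 (by linarith)))
  -- The largest `t` allowed with `b = 2c`, since then `6tb = β(1 - β)`. The resulting scale `2β /
  -- t` is `24c / (1 - β)`.
  have ht : 1 ≤ β * (1 - β) / (12 * c) := by rw [le_div_iff₀ (by positivity)]; linarith
  have h := expMoment_fixedPt_sub_le hQ₀ hβ₀ hβ₁ hU hl hlog hv hw hwfix ht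
    (b := 2 * c) (by positivity) (le_of_eq (by field_simp; norm_num)) hd2
  rw [← hB] at h
  have hc' : 2 * β / (β * (1 - β) / (12 * c)) = 24 / (1 - β) * c := by field_simp; norm_num
  rw [hc'] at h
  have h2 := luxNorm_one_le_of_expMoment_le (μ := Q₀) (f := w - v) (c := 24 / (1 - β) * c)
    (by positivity) hm1 (h.trans (by
      rw [← ENNReal.ofReal_toReal hBt.ne]
      exact ENNReal.ofReal_le_ofReal (le_max_right _ _)))
  rwa [← mul_assoc] at h2

/-- The errors of the estimated distortion are of the order of the error of the fixed point. -/
lemma exists_eLpNorm_distortion_le (hQ₀ : Kernel.Invariant Q Q₀) {β θ : ℝ} (hβ₀ : 0 < β)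
    (hβ₁ : β < 1) {u : X × X → ℝ} (hu : HasExpMoments (Q₀ ⊗ₘ Q) u)
    {v : X → ℝ} (hv : HasExpMoments Q₀ v) (hfix : cvOp β θ u Q v =ᵐ[Q₀] v) {p : ℝ} (hp : 1 < p) :
    ∃ N : ℝ, 0 < N ∧ ∀ (w : X → ℝ) (c : ℝ), Measurable w → 0 < c → 16 * p * c ≤ β →
      luxNorm 1 (w - v) Q₀ ≤ ENNReal.ofReal c →
      eLpNorm (distortionEst β θ u w - distortion β θ u Q v) (ENNReal.ofReal p) (Q₀ ⊗ₘ Q) ≤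
          ENNReal.ofReal (N * c) ∧
        eLpNorm (fun z => distortionEst β θ u w z / distortion β θ u Q v z - 1)
          (ENNReal.ofReal p) (Q₀ ⊗ₘ Q) ≤ ENNReal.ofReal (N * c) := by
  have hum := hu.1
  have hvm := hv.1
  have hp0 : 0 < p := by linarith
  -- The logarithm of `m_v` almost everywhere, by the fixed point equation. Below, `B₁` serves the
  -- difference of the distortions, and `B₂`, with `g = 0`, their ratio.
  set g : X × X → ℝ := fun z => v z.2 + riskCoef β θ * u z - β⁻¹ * v z.1 with hg
  have hgm : HasExpMoments (Q₀ ⊗ₘ Q) g :=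
    ((hv.comp_snd hQ₀).add (hu.const_mul _)).sub (hv.comp_fst.const_mul β⁻¹)
  have hgmeas : Measurable g := hgm.1
  set B₁ : ℝ≥0∞ := (expMoment (Q₀ ⊗ₘ Q) (fun z => 2 * p * g z) + 4) ^ (1 / p) with hB₁
  set B₂ : ℝ≥0∞ := (expMoment (Q₀ ⊗ₘ Q) (fun _ => 2 * p * 0) + 4) ^ (1 / p) with hB₂
  have hB₁t : B₁ ≠ ∞ := ENNReal.rpow_ne_top_of_nonneg (by positivity)
    (ENNReal.add_lt_top.2 ⟨hgm.2 _, by simp⟩).ne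
  have hB₂t : B₂ ≠ ∞ := ENNReal.rpow_ne_top_of_nonneg (by positivity)
    (ENNReal.add_lt_top.2 ⟨by simp [expMoment], by simp⟩).ne
  set m := B₁.toReal + B₂.toReal + 1 with hm
  have hm0 : 0 < m := by positivity
  have hB₁m : B₁ ≤ ENNReal.ofReal m := by
    rw [← ENNReal.ofReal_toReal hB₁t]
    exact ENNReal.ofReal_le_ofReal (by
      linarith [ENNReal.toReal_nonneg (a := B₂)])
  have hB₂m : B₂ ≤ ENNReal.ofReal m := by
    rw [← ENNReal.ofReal_toReal hB₂t]
    exact ENNReal.ofReal_le_ofReal (by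
      linarith [ENNReal.toReal_nonneg (a := B₁)])
  refine ⟨16 * p / β * m, by positivity, ?_⟩
  intro w c hw hc hpc hlux
  set δ : X → ℝ := w - v with hδ
  have hδm : Measurable δ := hw.sub hvm
  have h2 := expMoment_abs_div_le_two (μ := Q₀) (f := δ) (c := 2 * c) (by positivity)
    (hlux.trans_lt ((ENNReal.ofReal_lt_ofReal_iff (by positivity)).2 (by linarith)))
  have h4 := expMoment_increment_le hQ₀ hβ₀ hβ₁ hδm (by positivity) h2
  -- With this scale for the increment `δ(y) - β⁻¹ δ(x)`, the condition `4pb ≤ 1` reads `16pc ≤ β`.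
  set b := 2 * (2 * c) / β with hb
  have hb0 : 0 < b := by positivity
  have hpb : 4 * p * b = 16 * p / β * c := by rw [hb]; ring
  have hpb1 : 4 * p * b ≤ 1 := by
    rw [hpb, div_mul_eq_mul_div, div_le_one hβ₀]; exact hpc
  have hfinal : ∀ D : ℝ≥0∞, D ≤ ENNReal.ofReal m →
      ENNReal.ofReal (4 * p * b) * D ≤ ENNReal.ofReal (16 * p / β * m * c) := fun D hD => by
    calc _ ≤ ENNReal.ofReal (4 * p * b) * ENNReal.ofReal m := by gcongr
      _ = _ := by
        rw [← ENNReal.ofReal_mul (by positivity), hpb]; congr 1; ring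
  have hae := distortion_ae_eq hQ₀ hβ₀ hu hv hfix
  have hEst : ∀ z, distortionEst β θ u w z =
      Real.exp (g z) * Real.exp (δ z.2 - β⁻¹ * δ z.1) := fun z => by
    rw [distortionEst, ← Real.exp_add]
    congr 1; simp only [hg, hδ, Pi.sub_apply]; ring
  constructor
  · refine le_trans (le_of_eq (eLpNorm_congr_ae ?_)) ((eLpNorm_exp_mul_exp_sub_one_le hgmeas
      (z := fun z : X × X => δ z.2 - β⁻¹ * δ z.1) hb0 hp0 hpb1 h4).trans (hfinal _ hB₁m))
    filter_upwards [hae] with z hz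
    rw [Pi.sub_apply, hz, hEst, distortionEst]
    simp only [hg]; ring
  · refine le_trans (le_of_eq (eLpNorm_congr_ae ?_)) ((eLpNorm_exp_mul_exp_sub_one_le
      (g := fun _ => 0) measurable_const (z := fun z : X × X => δ z.2 - β⁻¹ * δ z.1) hb0 hp0
      hpb1 h4).trans (hfinal _ hB₂m))
    filter_upwards [hae] with z hz
    rw [hz, hEst, distortionEst, Real.exp_zero, one_mul, mul_comm,
      mul_div_assoc, div_self (Real.exp_pos _).ne', mul_one]

end Rates

end RobustCV

/-! ### Assembly of the theorem. -/

theorem proposition5p1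
    {X : Type*} [MeasurableSpace X] [MeasurableSpace.CountablyGenerated X]
    -- benchmark model with its stationary distribution
    (Q : Kernel X X) [IsMarkovKernel Q]
    (Q₀ : Measure X) [IsProbabilityMeasure Q₀] (hQ₀ : Kernel.Invariant Q Q₀)
    -- preference parameters and utility growth
    (β θ : ℝ) (hβ₀ : 0 < β) (hβ₁ : β < 1) (hθ : 0 < θ)
    (u : X × X → ℝ) (r : ℝ) (hr : 1 < r)
    (hU : RobustCV.MemOrliczHeart r u (Q₀ ⊗ₘ Q))
    (M : ℝ)
    (hM : ∫⁻ z, ENNReal.ofReal (Real.exp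
      (|RobustCV.riskCoef β θ / (1 - β) * u z| ^ r)) ∂(Q₀ ⊗ₘ Q) ≤ ENNReal.ofReal M)
    -- the estimators of the benchmark model
    {Ω : Type*} [MeasurableSpace Ω] (P : Measure Ω) [IsProbabilityMeasure P]
    (Qhat : ℕ → Ω → Kernel X X) (hQhat : ∀ n ω, IsMarkovKernel (Qhat n ω))
    (a : ℕ → ℝ) (ha₀ : ∀ n, 0 < a n) (ha : Tendsto a atTop (𝓝 0))
    (hAM2 : RobustCV.WPA1 P (fun n ω => RobustCV.AM2 r β θ M u Q₀ Q (Qhat n ω)))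
    (hη : RobustCV.IsLittleOP P
      (fun n ω => RobustCV.luxNorm 1 (RobustCV.score Q (Qhat n ω)) (Q₀ ⊗ₘ Q))) :
    -- the continuation value and (wpa1) its plug-in estimate are well defined
    (∃ v : X → ℝ, RobustCV.IsUniqueFixedPt r β θ u Q₀ Q v) ∧
    RobustCV.WPA1 P (fun n ω =>
      ∃ w : X → ℝ, RobustCV.IsUniqueFixedPt r β θ u Q₀ (Qhat n ω) w) ∧
    -- convergence rates
    ∀ v : X → ℝ, RobustCV.IsFixedPt r β θ u Q₀ Q v →
      RobustCV.IsBigOP P (fun n ω =>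
        RobustCV.luxNorm 1 (RobustCV.cvOp β θ u (Qhat n ω) v - v) Q₀) a →
      ∀ vhat : ℕ → Ω → X → ℝ,
        RobustCV.WPA1 P (fun n ω =>
          RobustCV.IsFixedPt r β θ u Q₀ (Qhat n ω) (vhat n ω)) →
        RobustCV.IsBigOP P (fun n ω => RobustCV.luxNorm 1 (vhat n ω - v) Q₀) a ∧
        ∀ p : ℝ, 1 < p →
          RobustCV.IsBigOP P (fun n ω =>
            eLpNorm (RobustCV.distortionEst β θ u (vhat n ω) - RobustCV.distortion β θ u Q v)
              (ENNReal.ofReal p) (Q₀ ⊗ₘ Q)) a ∧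
          RobustCV.IsBigOP P (fun n ω =>
            eLpNorm (fun z => RobustCV.distortionEst β θ u (vhat n ω) z /
                RobustCV.distortion β θ u Q v z - 1)
              (ENNReal.ofReal p) (Q₀ ⊗ₘ Q)) a := by
  have hue := hU.hasExpMoments hr.le
  have h1β : 0 < 1 - β := by linarith
  refine ⟨RobustCV.exists_isUniqueFixedPt hQ₀ hβ₀ hβ₁ hr hU, hAM2.mono fun n ω h => ?_, ?_⟩
  · have := hQhat n ω
    exact RobustCV.exists_isUniqueFixedPt_of_AM2 hQ₀ hβ₀ hβ₁ hr hU h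
  intro v hv hd vhat hvhat
  have hve := hv.1.hasExpMoments hr.le
  -- Since `a n → 0`, the smallness thresholds of the deterministic bounds hold eventually, for each
  -- fixed `C`.
  have hsmall : ∀ C D : ℝ, 0 < D → ∀ᶠ n in atTop, C * a n ≤ D := fun C D hD => by
    have h := ha.const_mul C
    rw [mul_zero] at h
    exact h.eventually_le_const hD
  have hrate : RobustCV.IsBigOP P
      (fun n ω => RobustCV.luxNorm 1 (vhat n ω - v) Q₀) a := by
    refine hd.of_eventually_imp ((hAM2.and hvhat).and
      (hη.wpa1 (ε := (1 - β) / 24) (by positivity))) fun C hC => ?_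
    obtain ⟨N, hN, h⟩ := RobustCV.exists_luxNorm_sub_le (θ := θ) hQ₀ hβ₀ hβ₁ hue hve
    refine ⟨N * C, by positivity, ?_⟩
    filter_upwards [hsmall (12 * C) (β * (1 - β)) (by positivity)] with n hn ω hω hdω
    have := hQhat n ω
    obtain ⟨⟨hA, hfix⟩, hsc⟩ := hω
    rw [mul_assoc]
    exact h (Qhat n ω) (vhat n ω) (C * a n) hA.1 hsc (hfix.1.hasExpMoments hr.le) hfix.2
      (mul_pos hC (ha₀ n)) (by linarith) hdω
  refine ⟨hrate, fun p hp => ?_⟩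
  have hp0 : 0 < p := by linarith
  obtain ⟨N, hN, h⟩ := RobustCV.exists_eLpNorm_distortion_le hQ₀ hβ₀ hβ₁ hue hve hv.2 hp
  constructor
  all_goals
    refine hrate.of_eventually_imp hvhat fun C hC => ⟨N * C, by positivity, ?_⟩
    filter_upwards [hsmall (16 * p * C) β hβ₀] with n hn ω hω hdω
    have h' := h (vhat n ω) (C * a n) hω.1.1.1 (mul_pos hC (ha₀ n)) (by linarith) hdω
    rw [mul_assoc N]
  · exact h'.1
  · exact h'.2
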